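/- All groups are finite. Let $\pi$ be a set of primes and $\pi'$ its complement in the set of all primes. A group is $\pi'$-soluble if each of its composition factors is either a $\pi$-group or a $p$-group for some prime $p\in\pi'$. Let $\mathfrak N^\pi$ be the class of all groups that are the direct product of a $\pi$-group and a nilpotent $\pi'$-group. For a group $X$, let $X^{\mathfrak N^\pi}$ be the smallest normal subgroup of $X$ with quotient in $\mathfrak N^\pi$, and $O^\pi(X)$ the smallest normal subgroup of $X$ whose quotient is a $\pi$-group. A subgroup $P$ of $X$ is an $\mathfrak N^\pi$-projector of $X$ if for every $N\unlhd X$ the group $PN/N$ is maximal among the subgroups of $X/N$ that belong to $\mathfrak N^\pi$. A subgroup $H$ of a group $X$ is $\mathfrak N^\pi$-Dnormal in $X$ if for every prime $p$ and every Sylow $p$-subgroup $X_p$ of $X$ such that $X_p\cap H$ is a Sylow $p$-subgroup of $H$: (1) if $p\in\pi'$, or if $\pi=\{p\}$, then $X_p\le N_X(H)$; (2) if $p\in\pi$ and $|\pi|\ge 2$, then $X_p\le N_X(O^\pi(H))$. A subgroup $S$ of $X$ is $\mathfrak N^\pi$-Dsubnormal in $X$ if there is a finite chain $S=S_0\le S_1\le\dots\le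 S_k=X$ with $S_i$ $\mathfrak N^\pi$-Dnormal in $S_{i+1}$ for $0\le i\le k-1$. A non-empty set $\mathcal F$ of subgroups of a group $G$ is an $\mathfrak N^\pi$-Fitting set of $G$ if: (FS1) $T\in\mathcal F$ whenever $T$ is $\mathfrak N^\pi$-Dsubnormal in some $S\in\mathcal F$; (FS2) $\langle S,T\rangle\in\mathcal F$ whenever $S,T\in\mathcal F$ are both $\mathfrak N^\pi$-Dnormal in $\langle S,T\rangle$; (FS3) $S^x=x^{-1}Sx\in\mathcal F$ whenever $S\in\mathcal F$ and $x\in G$. For $H\le G$, a subgroup is $\mathcal F$-maximal in $H$ if it is maximal among the subgroups of $H$ that lie in $\mathcal F$, and $H_{\mathcal F}$ denotes the join of all normal subgroups of $H$ that lie in $\mathcal F$. Lemma. Let $\mathcal F$ be an $\mathfrak N^\pi$-Fitting set of a $\pi'$-soluble group $G$. Let $K$ be a normal subgroup of $G$ containing $G^{\mathfrak N^\pi}$, let $W$ be an $\mathcal F$-maximal subgroup of $K$, and let $V$ and $V_1$ be $\mathcal F$-maximal subgroups of $G$ which contain $W$. (a) If $W\unlhd K$, then there is an $\mathfrak N^\pi$-projector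 $P$ of $G$ such that $WP$ is a subgroup of $G$ and $V=(WP)_{\mathcal F}$. (b) In any case, $V$ and $V_1$ are conjugate in $\langle V,V_1\rangle$; more precisely, there exists $x\in\langle V,V_1\rangle^{\mathfrak N^\pi}$ such that $V_1^x=V$. -/

import Mathlib

open scoped Pointwise

/-- The complement `ρ'` of `ρ` in the set of all primes. -/
def primeCompl (ρ : Set ℕ) : Set ℕ := {p | p.Prime ∧ p ∉ ρ}

/-- A (finite) `ρ`-group: every prime divisor of its order lies in `ρ`. -/
def IsPiGroup (ρ : Set ℕ) (G : Type*) [Group G] : Prop :=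
  ∀ p : ℕ, p.Prime → p ∣ Nat.card G → p ∈ ρ

/-- The class `𝔑^π = 𝔈_π × 𝔑_{π'}`: the group is the internal direct product of a `π`-group and a
nilpotent `π'`-group. -/
def IsNPiGroup (π : Set ℕ) (G : Type*) [Group G] : Prop :=
  ∃ H K : Subgroup G, H.Normal ∧ K.Normal ∧ IsCompl H K ∧
    IsPiGroup π H ∧ IsPiGroup (primeCompl π) K ∧ Group.IsNilpotent K

/-- `1 = s 0 ≤ s 1 ≤ ⋯ ≤ s n = G` is a composition series of `G`: each term is normal in the next
one, with simple quotient. -/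
def IsCompositionSeries {G : Type*} [Group G] {n : ℕ} (s : Fin (n + 1) → Subgroup G) : Prop :=
  s 0 = ⊥ ∧ s (Fin.last n) = ⊤ ∧ ∀ i : Fin n, s i.castSucc ≤ s i.succ ∧
    ∃ _ : ((s i.castSucc).subgroupOf (s i.succ)).Normal,
      IsSimpleGroup (s i.succ ⧸ (s i.castSucc).subgroupOf (s i.succ))

/-- A finite group is `ρ`-soluble if each of its composition factors is a `ρ`-group or a
`ρ'`-group (`ρ`-separability), and each composition factor that is a `ρ`-group is a `p`-group for
some prime `p ∈ ρ`. -/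
def IsPiSoluble (ρ : Set ℕ) (G : Type*) [Group G] : Prop :=
  ∀ (n : ℕ) (s : Fin (n + 1) → Subgroup G), IsCompositionSeries s → ∀ i : Fin n,
    ∀ _ : ((s i.castSucc).subgroupOf (s i.succ)).Normal,
      (IsPiGroup ρ (s i.succ ⧸ (s i.castSucc).subgroupOf (s i.succ)) ∨
        IsPiGroup (primeCompl ρ) (s i.succ ⧸ (s i.castSucc).subgroupOf (s i.succ))) ∧
      (IsPiGroup ρ (s i.succ ⧸ (s i.castSucc).subgroupOf (s i.succ)) →
        ∃ p ∈ ρ, p.Prime ∧ IsPGroup p (s i.succ ⧸ (s i.castSucc).subgroupOf (s i.succ)))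

/-- `O^π(G)`: the smallest normal subgroup of `G` whose quotient is a `π`-group. -/
def piResidual (π : Set ℕ) (G : Type*) [Group G] : Subgroup G :=
  sInf {N : Subgroup G | ∃ _ : N.Normal, IsPiGroup π (G ⧸ N)}

/-- `G^{𝔑^π}`: the smallest normal subgroup of `G` whose quotient is an `𝔑^π`-group. -/
def nPiResidual (π : Set ℕ) (G : Type*) [Group G] : Subgroup G :=
  sInf {N : Subgroup G | ∃ _ : N.Normal, IsNPiGroup π (G ⧸ N)}

/-- `O^π(H)` for a subgroup `H` of `G`, as a subgroup of `G`. -/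
def piResidualOf {G : Type*} [Group G] (π : Set ℕ) (H : Subgroup G) : Subgroup G :=
  (piResidual π H).map H.subtype

/-- `H^{𝔑^π}` for a subgroup `H` of `G`, as a subgroup of `G`. -/
def nPiResidualOf {G : Type*} [Group G] (π : Set ℕ) (H : Subgroup G) : Subgroup G :=
  (nPiResidual π H).map H.subtype

/-- The Sylow `p`-subgroup `P` of `G` reduces into `H`: `P ∩ H` is a Sylow `p`-subgroup of `H`. -/
def SylowReduces {G : Type*} [Group G] {p : ℕ} (P : Sylow p G) (H : Subgroup G) : Prop :=
  ∃ Q : Sylow p H, (Q : Subgroup H) = (P : Subgroup G).subgroupOf H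

/-- `H` is `𝔑^π`-Dnormal in the whole group `G`. -/
def IsDnormal {G : Type*} [Group G] (π : Set ℕ) (H : Subgroup G) : Prop :=
  (∀ p ∈ primeCompl π, ∀ P : Sylow p G, SylowReduces P H →
    (P : Subgroup G) ≤ Subgroup.normalizer (H : Set G)) ∧
  (∀ p ∈ π, ∀ P : Sylow p G, SylowReduces P H →
    (π = {p} → (P : Subgroup G) ≤ Subgroup.normalizer (H : Set G)) ∧
    (π.Nontrivial → (P : Subgroup G) ≤ Subgroup.normalizer (piResidualOf π H : Set G)))

/-- `H` is a subgroup of `L` and is `𝔑^π`-Dnormal in `L`. -/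
def IsDnormalIn {G : Type*} [Group G] (π : Set ℕ) (H L : Subgroup G) : Prop :=
  H ≤ L ∧ IsDnormal π (H.subgroupOf L)

/-- `S` is `𝔑^π`-Dsubnormal in `L`: there is a finite chain `S = S₀ ≤ S₁ ≤ ⋯ ≤ S_k = L` in which
every term is `𝔑^π`-Dnormal in the next one. -/
def IsDsubnormalIn {G : Type*} [Group G] (π : Set ℕ) (S L : Subgroup G) : Prop :=
  Relation.ReflTransGen (IsDnormalIn π) S L

/-- The conjugate `S^x = x⁻¹ S x`. -/
def conjSubgroup {G : Type*} [Group G] (S : Subgroup G) (x : G) : Subgroup G :=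
  S.map (MulAut.conj x⁻¹).toMonoidHom

/-- `𝓕` is an `𝔑^π`-Fitting set of `G`. -/
structure IsNPiFittingSet {G : Type*} [Group G] (π : Set ℕ) (𝓕 : Set (Subgroup G)) : Prop where
  nonempty : 𝓕.Nonempty
  fs1 : ∀ S T : Subgroup G, S ∈ 𝓕 → IsDsubnormalIn π T S → T ∈ 𝓕
  fs2 : ∀ S T : Subgroup G, S ∈ 𝓕 → T ∈ 𝓕 → IsDnormalIn π S (S ⊔ T) →
    IsDnormalIn π T (S ⊔ T) → S ⊔ T ∈ 𝓕
  fs3 : ∀ (S : Subgroup G) (x : G), S ∈ 𝓕 → conjSubgroup S x ∈ 𝓕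

/-- `V` is an `𝓕`-maximal subgroup of `L`: maximal among the subgroups of `L` in `𝓕`. -/
def IsFMaximalIn {G : Type*} [Group G] (𝓕 : Set (Subgroup G)) (L V : Subgroup G) : Prop :=
  Maximal (fun S : Subgroup G => S ≤ L ∧ S ∈ 𝓕) V

/-- The `𝓕`-radical `H_𝓕` of a subgroup `H`: the join of all normal subgroups of `H` in `𝓕`. -/
def fRadical {G : Type*} [Group G] (𝓕 : Set (Subgroup G)) (H : Subgroup G) : Subgroup G :=
  sSup {S : Subgroup G | S ≤ H ∧ (S.subgroupOf H).Normal ∧ S ∈ 𝓕}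

/-- `P` is an `𝔑^π`-projector of `G`: for every normal subgroup `N` of `G`, `PN/N` is maximal among
the subgroups of `G/N` that are `𝔑^π`-groups. -/
def IsNPiProjector {G : Type*} [Group G] (π : Set ℕ) (P : Subgroup G) : Prop :=
  ∀ (N : Subgroup G) [N.Normal],
    Maximal (fun U : Subgroup (G ⧸ N) => IsNPiGroup π U) (P.map (QuotientGroup.mk' N))

/-! Write O^ρ(T) for `oRes ρ T` and T^𝔑 for `cRes π T`. Both are generated by words in elements of
prime power order, so they are monotone in T and commute with homomorphisms, and T lies in 𝔑^π
exactly when T^𝔑 = 1 (`isNPiGroup_subgroup_iff`).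

The projectors used are covering subgroups P of L: P ∈ 𝔑^π and T = P T^𝔑 whenever P ≤ T ≤ L.
Induction along a normal π-subgroup or abelian p-subgroup gives their existence and their conjugacy
under L^𝔑 (`exists_isCovering`, `exists_conj_eq_of_isCovering`).

Let K be normal in L and contain L^𝔑, let W be 𝓕-maximal in K and normal in L, and let V ≥ W be
𝓕-maximal in L. Then V ∩ K = W. If P is a covering subgroup of N_L(V), then (PV)^𝔑 ≤ V ∩ K = W, so V
≤ PW ≤ N_L(V), and V is the largest normal 𝓕-subgroup of PW. The crux is that P is also a covering
subgroup of L (`isCovering_of_isCovering_normalizer`). This gives (a) once W is seen to be normal in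
G. For (b), take L = ⟨V, V₁⟩, which normalizes W: an element of L^𝔑 conjugating the covering
subgroups carries PW to P₁W, hence V to V₁.

By induction on L the crux reduces to L = N_L(V)K (`IsFMaximalIn.le_normalizer_inf_sup`). Suppose Y
= N_L(V)K is proper. Conjugacy in Y and the Frattini argument make Y self-normalizing in L, so
O^π(L) ≤ Y because L/L^𝔑 is in 𝔑^π. Then D = K O^π(V) is normal in L, and Frattini in D yields L =
N_L(B)K for B = W O^π(V). Some H with V ≤ H ≤ N_L(B) has O^π(H) = O^π(V) and covers
N_L(B)/O^π(N_L(B)). Here Dnormality is essential: V is Dnormal in H, though not visibly normal, and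
maximality of V then forces H to normalize V. So L ≤ N_L(V) O^π(L) K ≤ Y, a contradiction. -/

open scoped commutatorElement

universe u

/-! ### Elements of prime power order and the two residuals. -/

/-- `x` has order a power of `p`. -/
def IsPElement {G : Type*} [Group G] (p : ℕ) (x : G) : Prop := ∃ k : ℕ, x ^ p ^ k = 1

/-- The subgroup generated by the `p`-elements of `T` with `p ∉ ρ`: the `ρ`-residual of `T`. -/
def oRes {G : Type*} [Group G] (ρ : Set ℕ) (T : Subgroup G) : Subgroup G :=
  Subgroup.closure {x | x ∈ T ∧ ∃ p : ℕ, p.Prime ∧ p ∉ ρ ∧ IsPElement p x}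

/-- The subgroup generated by the commutators of `p`-elements with `q`-elements of `T`, where
`p ≠ q` are not both in `π`: the `𝔑^π`-residual of `T`. -/
def cRes {G : Type*} [Group G] (π : Set ℕ) (T : Subgroup G) : Subgroup G :=
  Subgroup.closure {c | ∃ p q : ℕ, p.Prime ∧ q.Prime ∧ p ≠ q ∧ (p ∈ π → q ∉ π) ∧
    ∃ x ∈ T, ∃ y ∈ T, IsPElement p x ∧ IsPElement q y ∧ c = ⁅x, y⁆}

section

variable {G G' : Type*} [Group G] [Group G']

theorem IsPElement.map {p : ℕ} {x : G} (h : IsPElement p x) (f : G →* G') :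
    IsPElement p (f x) := by
  obtain ⟨k, hk⟩ := h
  exact ⟨k, by rw [← map_pow, hk, map_one]⟩

theorem IsPElement.of_map {p : ℕ} {x : G} {f : G →* G'} (hf : Function.Injective f)
    (h : IsPElement p (f x)) : IsPElement p x := by
  obtain ⟨k, hk⟩ := h
  exact ⟨k, hf (by rw [map_pow, hk, map_one])⟩

/-- The `p`-part of `x` is a power of `x`, and it has the same image because that image already is a
`p`-element. -/
theorem IsPElement.exists_lift [Finite G] {p : ℕ} (hp : p.Prime) (f : G →* G') {x : G}
    (h : IsPElement p (f x)) : ∃ k : ℕ, IsPElement p (x ^ k) ∧ f (x ^ k) = f x := by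
  obtain ⟨b, hb⟩ := h
  obtain ⟨a, m, hm, hn⟩ := Nat.exists_eq_pow_mul_and_not_dvd (orderOf_pos x).ne' p hp.ne_one
  have hc : Nat.Coprime (p ^ b) m := ((Nat.Prime.coprime_iff_not_dvd hp).2 hm).pow_left b
  -- An exponent divisible by `m` kills the `p'`-part of `x`; being 1 modulo `p ^ b`, it fixes `f
  -- x`.
  obtain ⟨k, hk1, hk2⟩ := Nat.chineseRemainder hc 1 0
  refine ⟨k, ⟨a, ?_⟩, ?_⟩
  · rw [← pow_mul, ← orderOf_dvd_iff_pow_eq_one, hn, mul_comm]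
    exact mul_dvd_mul ((Nat.modEq_zero_iff_dvd).1 hk2) dvd_rfl
  · have : orderOf (f x) ∣ p ^ b := orderOf_dvd_of_pow_eq_one hb
    have h2 : k ≡ 1 [MOD orderOf (f x)] := hk1.of_dvd this
    rw [map_pow, pow_eq_pow_iff_modEq.2 h2, pow_one]

theorem oRes_le (ρ : Set ℕ) (T : Subgroup G) : oRes ρ T ≤ T :=
  (Subgroup.closure_le _).2 fun _ hx => hx.1

theorem mem_oRes {ρ : Set ℕ} {T : Subgroup G} {x : G} (hx : x ∈ T) {p : ℕ} (hp : p.Prime)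
    (hpρ : p ∉ ρ) (h : IsPElement p x) : x ∈ oRes ρ T :=
  Subgroup.subset_closure ⟨hx, p, hp, hpρ, h⟩

theorem oRes_le_iff {ρ : Set ℕ} {T S : Subgroup G} :
    oRes ρ T ≤ S ↔ ∀ x ∈ T, ∀ p : ℕ, p.Prime → p ∉ ρ → IsPElement p x → x ∈ S := by
  rw [oRes, Subgroup.closure_le]
  exact ⟨fun h x hx p hp hpρ hxp => h ⟨hx, p, hp, hpρ, hxp⟩,
    fun h x ⟨hx, p, hp, hpρ, hxp⟩ => h x hx p hp hpρ hxp⟩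

theorem oRes_mono {ρ : Set ℕ} {T S : Subgroup G} (h : T ≤ S) : oRes ρ T ≤ oRes ρ S :=
  oRes_le_iff.2 fun _ hx _ hp hpρ hxp => mem_oRes (h hx) hp hpρ hxp

theorem oRes_le_oRes {ρ : Set ℕ} {T S : Subgroup G} (h : oRes ρ T ≤ S) : oRes ρ T ≤ oRes ρ S :=
  oRes_le_iff.2 fun _ hx _ hp hpρ hxp => mem_oRes (h (mem_oRes hx hp hpρ hxp)) hp hpρ hxp

/-- Prime power generators of the image lift to prime power generators of `T`, by
`IsPElement.exists_lift`. This compatibility with quotients and embeddings replaces any use of the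
universal property of residuals. -/
theorem oRes_map [Finite G] (ρ : Set ℕ) (f : G →* G') (T : Subgroup G) :
    (oRes ρ T).map f = oRes ρ (T.map f) := by
  apply le_antisymm
  · rw [Subgroup.map_le_iff_le_comap, oRes_le_iff]
    exact fun x hx p hp hpρ hxp => mem_oRes (Subgroup.mem_map_of_mem f hx) hp hpρ (hxp.map f)
  · rw [oRes_le_iff]
    rintro _ ⟨x, hx, rfl⟩ p hp hpρ hxp
    obtain ⟨k, hk, hk'⟩ := hxp.exists_lift hp
    exact ⟨x ^ k, mem_oRes (T.pow_mem hx k) hp hpρ hk, hk'⟩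

theorem mem_cRes {π : Set ℕ} {T : Subgroup G} {p q : ℕ} (hp : p.Prime) (hq : q.Prime)
    (hpq : p ≠ q) (hπ : p ∈ π → q ∉ π) {x y : G} (hx : x ∈ T) (hy : y ∈ T)
    (hxp : IsPElement p x) (hyq : IsPElement q y) : ⁅x, y⁆ ∈ cRes π T :=
  Subgroup.subset_closure ⟨p, q, hp, hq, hpq, hπ, x, hx, y, hy, hxp, hyq, rfl⟩

theorem cRes_le_iff {π : Set ℕ} {T S : Subgroup G} :
    cRes π T ≤ S ↔ ∀ p q : ℕ, p.Prime → q.Prime → p ≠ q → (p ∈ π → q ∉ π) →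
      ∀ x ∈ T, ∀ y ∈ T, IsPElement p x → IsPElement q y → ⁅x, y⁆ ∈ S := by
  rw [cRes, Subgroup.closure_le]
  constructor
  · exact fun h p q hp hq hpq hπ x hx y hy hxp hyq =>
      h ⟨p, q, hp, hq, hpq, hπ, x, hx, y, hy, hxp, hyq, rfl⟩
  · rintro h _ ⟨p, q, hp, hq, hpq, hπ, x, hx, y, hy, hxp, hyq, rfl⟩
    exact h p q hp hq hpq hπ x hx y hy hxp hyq

theorem cRes_mono {π : Set ℕ} {T S : Subgroup G} (h : T ≤ S) : cRes π T ≤ cRes π S :=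
  cRes_le_iff.2 fun _ _ hp hq hpq hπ _ hx _ hy hxp hyq =>
    mem_cRes hp hq hpq hπ (h hx) (h hy) hxp hyq

theorem cRes_le (π : Set ℕ) (T : Subgroup G) : cRes π T ≤ T :=
  cRes_le_iff.2 fun _ _ _ _ _ _ _ hx _ hy _ _ =>
    T.mul_mem (T.mul_mem (T.mul_mem hx hy) (T.inv_mem hx)) (T.inv_mem hy)

theorem cRes_map [Finite G] (π : Set ℕ) (f : G →* G') (T : Subgroup G) :
    (cRes π T).map f = cRes π (T.map f) := by
  apply le_antisymm
  · rw [Subgroup.map_le_iff_le_comap, cRes_le_iff]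
    intro p q hp hq hpq hπ x hx y hy hxp hyq
    rw [Subgroup.mem_comap, map_commutatorElement]
    exact mem_cRes hp hq hpq hπ (Subgroup.mem_map_of_mem f hx) (Subgroup.mem_map_of_mem f hy)
      (hxp.map f) (hyq.map f)
  · rw [cRes_le_iff]
    rintro p q hp hq hpq hπ _ ⟨x, hx, rfl⟩ _ ⟨y, hy, rfl⟩ hxp hyq
    obtain ⟨k, hk, hk'⟩ := hxp.exists_lift hp
    obtain ⟨l, hl, hl'⟩ := hyq.exists_lift hq
    rw [← hk', ← hl', ← map_commutatorElement]
    exact Subgroup.mem_map_of_mem f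
      (mem_cRes hp hq hpq hπ (T.pow_mem hx k) (T.pow_mem hy l) hk hl)

/-- Every element of finite order is a product of powers of itself of prime power order, by Bézout
along coprime factors of the exponent. -/
theorem le_oRes_empty [Finite G] (T : Subgroup G) : T ≤ oRes ∅ T := by
  have key : ∀ n : ℕ, n ≠ 0 → ∀ x ∈ T, x ^ n = 1 → x ∈ oRes ∅ T := by
    intro n
    induction n using Nat.recOnPosPrimePosCoprime with
    | zero => exact fun h => absurd rfl h
    | one => intro _ x _ h; rw [pow_one] at h; exact h ▸ Subgroup.one_mem _
    | prime_pow p n hp hn =>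
      exact fun _ x hx h => mem_oRes hx hp (Set.notMem_empty p) ⟨n, h⟩
    | coprime a b ha hb hab iha ihb =>
      intro _ x hx h
      have h1 := ihb (by lia) (x ^ a) (T.pow_mem hx a) (by rw [← pow_mul, h])
      have h2 := iha (by lia) (x ^ b) (T.pow_mem hx b) (by rw [← pow_mul, mul_comm, h])
      have hg := Nat.gcd_eq_gcd_ab a b
      rw [hab.gcd_eq_one] at hg
      have : x = (x ^ a) ^ (a.gcdA b) * (x ^ b) ^ (a.gcdB b) := by
        rw [← zpow_natCast x a, ← zpow_natCast x b, ← zpow_mul, ← zpow_mul, ← zpow_add, ← hg]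
        simp
      rw [this]
      exact Subgroup.mul_mem _ (Subgroup.zpow_mem _ h1 _) (Subgroup.zpow_mem _ h2 _)
  exact fun x hx => key (orderOf x) (orderOf_pos x).ne' x hx (pow_orderOf_eq_one x)

theorem le_of_pElements [Finite G] {T S : Subgroup G}
    (h : ∀ x ∈ T, ∀ p : ℕ, p.Prime → IsPElement p x → x ∈ S) : T ≤ S :=
  (le_oRes_empty T).trans (oRes_le_iff.2 fun x hx p hp _ hxp => h x hx p hp hxp)

theorem oRes_eq_bot_iff {ρ : Set ℕ} {T : Subgroup G} :
    oRes ρ T = ⊥ ↔ ∀ x ∈ T, ∀ p : ℕ, p.Prime → p ∉ ρ → IsPElement p x → x = 1 := by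
  rw [eq_bot_iff, oRes_le_iff]; rfl

/-- Cauchy's theorem in one direction, Lagrange's in the other; this links `oRes` to `ρ`-groups. -/
theorem oRes_eq_bot_iff_card [Finite G] {ρ : Set ℕ} {T : Subgroup G} :
    oRes ρ T = ⊥ ↔ ∀ p : ℕ, p.Prime → p ∣ Nat.card T → p ∈ ρ := by
  rw [oRes_eq_bot_iff]
  constructor
  · intro h p hp hd
    by_contra hpρ
    have := Fact.mk hp
    obtain ⟨x, hx⟩ := exists_prime_orderOf_dvd_card' p hd
    have h1 := h x x.2 p hp hpρ ⟨1, by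
      rw [pow_one, ← hx]; exact_mod_cast congrArg Subtype.val (pow_orderOf_eq_one x)⟩
    have : x = 1 := Subtype.ext h1
    rw [this, orderOf_one] at hx
    exact hp.ne_one hx.symm
  · rintro h x hx p hp hpρ ⟨k, hk⟩
    by_contra hne
    have h1 : orderOf (⟨x, hx⟩ : T) ∣ p ^ k :=
      orderOf_dvd_of_pow_eq_one (Subtype.ext (by simpa using hk))
    obtain ⟨j, _, hj⟩ := (Nat.dvd_prime_pow hp).1 h1
    have hj0 : j ≠ 0 := by
      rintro rfl
      rw [pow_zero, orderOf_eq_one_iff] at hj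
      exact hne (congrArg Subtype.val hj)
    exact hpρ (h p hp (((dvd_pow_self p hj0).trans hj.symm.dvd).trans (orderOf_dvd_natCard _)))

theorem mem_normalizer_iff_conj_smul {H : Subgroup G} {g : G} :
    g ∈ Subgroup.normalizer (H : Set G) ↔ MulAut.conj g • H = H :=
  Subgroup.mem_normalizer_iff_map_conj_eq

theorem oRes_conj [Finite G] (ρ : Set ℕ) (T : Subgroup G) (g : G) :
    oRes ρ (MulAut.conj g • T) = MulAut.conj g • oRes ρ T :=
  (oRes_map ρ (MulAut.conj g).toMonoidHom T).symm

theorem cRes_conj [Finite G] (π : Set ℕ) (T : Subgroup G) (g : G) :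
    cRes π (MulAut.conj g • T) = MulAut.conj g • cRes π T :=
  (cRes_map π (MulAut.conj g).toMonoidHom T).symm

theorem normalizer_le_normalizer_oRes [Finite G] (ρ : Set ℕ) (T : Subgroup G) :
    Subgroup.normalizer (T : Set G) ≤ Subgroup.normalizer (oRes ρ T : Set G) := fun g hg => by
  rw [mem_normalizer_iff_conj_smul] at hg ⊢
  rw [← oRes_conj, hg]

theorem normalizer_le_normalizer_cRes [Finite G] (π : Set ℕ) (T : Subgroup G) :
    Subgroup.normalizer (T : Set G) ≤ Subgroup.normalizer (cRes π T : Set G) := fun g hg => by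
  rw [mem_normalizer_iff_conj_smul] at hg ⊢
  rw [← cRes_conj, hg]

theorem le_normalizer_oRes [Finite G] (ρ : Set ℕ) (T : Subgroup G) :
    T ≤ Subgroup.normalizer (oRes ρ T : Set G) :=
  Subgroup.le_normalizer.trans (normalizer_le_normalizer_oRes ρ T)

theorem le_normalizer_cRes [Finite G] (π : Set ℕ) (T : Subgroup G) :
    T ≤ Subgroup.normalizer (cRes π T : Set G) :=
  Subgroup.le_normalizer.trans (normalizer_le_normalizer_cRes π T)

theorem le_normalizer_sup {A H K : Subgroup G} (hH : A ≤ Subgroup.normalizer (H : Set G))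
    (hK : A ≤ Subgroup.normalizer (K : Set G)) :
    A ≤ Subgroup.normalizer ((H ⊔ K : Subgroup G) : Set G) :=
  (le_inf hH hK).trans (Subgroup.normalizer_inf_normalizer_le_normalizer_sup H K)

theorem le_normalizer_inf {A H K : Subgroup G} (hH : A ≤ Subgroup.normalizer (H : Set G))
    (hK : A ≤ Subgroup.normalizer (K : Set G)) :
    A ≤ Subgroup.normalizer ((H ⊓ K : Subgroup G) : Set G) := fun g hg => by
  have h1 := hH hg
  have h2 := hK hg
  rw [mem_normalizer_iff_conj_smul] at h1 h2 ⊢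
  rw [Subgroup.smul_inf, h1, h2]

/-- A subgroup contained in the join of `T` and a subgroup normalized by `T` decomposes. -/
theorem exists_mul_of_mem_sup {T N : Subgroup G} (hT : T ≤ Subgroup.normalizer (N : Set G))
    {x : G} (hx : x ∈ T ⊔ N) : ∃ t ∈ T, ∃ n ∈ N, t * n = x := by
  have : x ∈ ((T ⊔ N : Subgroup G) : Set G) := hx
  rw [Subgroup.coe_mul_of_left_le_normalizer_right T N hT] at this
  exact this

/-- The modular law for subgroups `T ≤ S` with `T` normalizing `N`. -/
theorem inf_sup_of_le {T N S : Subgroup G} (hT : T ≤ Subgroup.normalizer (N : Set G))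
    (hTS : T ≤ S) (hS : S ≤ T ⊔ N) : S ≤ T ⊔ (S ⊓ N) := by
  intro x hx
  obtain ⟨t, ht, n, hn, rfl⟩ := exists_mul_of_mem_sup hT (hS hx)
  refine Subgroup.mul_mem_sup ht ⟨?_, hn⟩
  have := S.mul_mem (S.inv_mem (hTS ht)) hx
  rwa [inv_mul_cancel_left] at this

end

/-! ### Residuals in subgroups and quotients. -/

section

variable {G G' : Type*} [Group G] [Group G']

theorem subgroupOf_normal_of_le {A N : Subgroup G} (h : A ≤ Subgroup.normalizer (N : Set G)) :
    (N.subgroupOf A).Normal := by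
  refine ⟨fun n hn a => ?_⟩
  rw [Subgroup.mem_subgroupOf] at hn ⊢
  exact (Subgroup.mem_normalizer_iff.1 (h a.2) n).1 hn

theorem le_normalizer_of_subgroupOf_normal {A N : Subgroup G} (hNA : N ≤ A)
    (h : (N.subgroupOf A).Normal) : A ≤ Subgroup.normalizer (N : Set G) := by
  have := Subgroup.normal_subgroupOf_iff_le_normalizer hNA
  exact this.1 h

theorem oRes_map_subtype_top [Finite G] (ρ : Set ℕ) (S : Subgroup G) :
    (oRes ρ (⊤ : Subgroup S)).map S.subtype = oRes ρ S := by
  rw [oRes_map, ← MonoidHom.range_eq_map, Subgroup.range_subtype]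

theorem cRes_map_subtype_top [Finite G] (π : Set ℕ) (S : Subgroup G) :
    (cRes π (⊤ : Subgroup S)).map S.subtype = cRes π S := by
  rw [cRes_map, ← MonoidHom.range_eq_map, Subgroup.range_subtype]

theorem oRes_map_subtype [Finite G] (ρ : Set ℕ) {T S : Subgroup G} (h : T ≤ S) :
    (oRes ρ (T.subgroupOf S)).map S.subtype = oRes ρ T := by
  rw [oRes_map, Subgroup.map_subgroupOf_eq_of_le h]

theorem cRes_map_subtype [Finite G] (π : Set ℕ) {T S : Subgroup G} (h : T ≤ S) :
    (cRes π (T.subgroupOf S)).map S.subtype = cRes π T := by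
  rw [cRes_map, Subgroup.map_subgroupOf_eq_of_le h]

/-- An operator on subgroups that commutes with homomorphisms is subadditive modulo a subgroup
normalized by its argument. -/
theorem op_sup_le_of_map [Finite G]
    (op : ∀ {X : Type _} [Group X] [Finite X], Subgroup X → Subgroup X)
    (hop : ∀ {X Y : Type _} [Group X] [Finite X] [Group Y] [Finite Y] (f : X →* Y)
      (T : Subgroup X), (op T).map f = op (T.map f))
    {T N : Subgroup G} (h : T ≤ Subgroup.normalizer (N : Set G)) :
    op (T ⊔ N) ≤ op T ⊔ N := by
  have hN : T ⊔ N ≤ Subgroup.normalizer (N : Set G) := sup_le h Subgroup.le_normalizer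
  have := subgroupOf_normal_of_le hN
  have key : op (⊤ : Subgroup ↥(T ⊔ N)) ≤ op (T.subgroupOf (T ⊔ N)) ⊔ N.subgroupOf (T ⊔ N) := by
    have h1 : (op (⊤ : Subgroup ↥(T ⊔ N))).map (QuotientGroup.mk' (N.subgroupOf (T ⊔ N))) ≤
        (op (T.subgroupOf (T ⊔ N))).map (QuotientGroup.mk' (N.subgroupOf (T ⊔ N))) := by
      rw [hop, hop]
      refine le_of_eq (congrArg _ ?_)
      have h2 : (⊤ : Subgroup ↥(T ⊔ N)) = T.subgroupOf (T ⊔ N) ⊔ N.subgroupOf (T ⊔ N) := by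
        rw [← Subgroup.subgroupOf_sup le_sup_left le_sup_right, Subgroup.subgroupOf_self]
      rw [h2, Subgroup.map_sup, QuotientGroup.map_mk'_self, sup_bot_eq]
    have h2 := (Subgroup.map_le_iff_le_comap).1 h1
    rwa [Subgroup.comap_map_eq, QuotientGroup.ker_mk'] at h2
  have h3 := Subgroup.map_mono (f := (T ⊔ N).subtype) key
  rw [Subgroup.map_sup, hop, hop, Subgroup.map_subgroupOf_eq_of_le le_sup_left,
    Subgroup.map_subgroupOf_eq_of_le le_sup_right, ← MonoidHom.range_eq_map,
    Subgroup.range_subtype] at h3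
  exact h3

theorem oRes_sup_le [Finite G] (ρ : Set ℕ) {T N : Subgroup G}
    (h : T ≤ Subgroup.normalizer (N : Set G)) : oRes ρ (T ⊔ N) ≤ oRes ρ T ⊔ N :=
  op_sup_le_of_map (fun S => oRes ρ S) (fun f T => oRes_map ρ f T) h

theorem cRes_sup_le [Finite G] (π : Set ℕ) {T N : Subgroup G}
    (h : T ≤ Subgroup.normalizer (N : Set G)) : cRes π (T ⊔ N) ≤ cRes π T ⊔ N :=
  op_sup_le_of_map (fun S => cRes π S) (fun f T => cRes_map π f T) h

theorem oRes_map_eq_bot [Finite G] {ρ : Set ℕ} {f : G →* G'} {T : Subgroup G} :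
    oRes ρ (T.map f) = ⊥ ↔ oRes ρ T ≤ f.ker := by
  rw [← oRes_map, Subgroup.map_eq_bot_iff]

theorem cRes_map_eq_bot [Finite G] {π : Set ℕ} {f : G →* G'} {T : Subgroup G} :
    cRes π (T.map f) = ⊥ ↔ cRes π T ≤ f.ker := by
  rw [← cRes_map, Subgroup.map_eq_bot_iff]

/-- A subgroup of `π`-elements is in `𝔑^π`, as is every `p`-group. -/
theorem cRes_eq_bot_of_oRes_eq_bot {π r : Set ℕ}
    (hr : r = π ∨ ∃ p, p ∉ π ∧ r = {p}) {T : Subgroup G} (h : oRes r T = ⊥) : cRes π T = ⊥ := by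
  rw [eq_bot_iff, cRes_le_iff]
  intro p q hp hq hpq hπ x hx y hy hxp hyq
  rw [oRes_eq_bot_iff] at h
  rw [Subgroup.mem_bot]
  by_cases h1 : p ∈ r
  · by_cases h2 : q ∈ r
    · rcases hr with rfl | ⟨s, _, rfl⟩
      · exact absurd h2 (hπ h1)
      · exact absurd (h1.trans h2.symm) hpq
    · rw [h y hy q hq h2 hyq, commutatorElement_one_right]
  · rw [h x hx p hp h1 hxp, commutatorElement_one_left]

theorem commute_of_cRes_eq_bot {π : Set ℕ} {T : Subgroup G} (h : cRes π T = ⊥) {p q : ℕ}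
    (hp : p.Prime) (hq : q.Prime) (hpq : p ≠ q) (hπ : p ∈ π → q ∉ π) {x y : G} (hx : x ∈ T)
    (hy : y ∈ T) (hxp : IsPElement p x) (hyq : IsPElement q y) : Commute x y := by
  have := mem_cRes hp hq hpq hπ hx hy hxp hyq
  rw [h, Subgroup.mem_bot] at this
  exact commutatorElement_eq_one_iff_commute.1 this

theorem coprime_card_of_oRes [Finite G] {r s : Set ℕ} {A B : Subgroup G} (hA : oRes r A = ⊥)
    (hB : oRes s B = ⊥) (hrs : ∀ p, p ∈ r → p ∉ s) : Nat.Coprime (Nat.card A) (Nat.card B) := by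
  rw [oRes_eq_bot_iff_card] at hA hB
  exact Nat.coprime_of_dvd fun p hp h1 h2 => hrs p (hA p hp h1) (hB p hp h2)

theorem inf_eq_bot_of_oRes [Finite G] {r s : Set ℕ} {A B : Subgroup G} (hA : oRes r A = ⊥)
    (hB : oRes s B = ⊥) (hrs : ∀ p, p ∈ r → p ∉ s) : A ⊓ B = ⊥ :=
  (Subgroup.disjoint_of_coprime_natCard (coprime_card_of_oRes hA hB hrs)).eq_bot

theorem oRes_eq_bot_of_le {ρ : Set ℕ} {A B : Subgroup G} (h : A ≤ B) (hB : oRes ρ B = ⊥) :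
    oRes ρ A = ⊥ := eq_bot_iff.2 ((oRes_mono h).trans hB.le)

theorem cRes_eq_bot_of_le {π : Set ℕ} {A B : Subgroup G} (h : A ≤ B) (hB : cRes π B = ⊥) :
    cRes π A = ⊥ := eq_bot_iff.2 ((cRes_mono h).trans hB.le)

/-- An extension of a `ρ`-group by a `ρ`-group is a `ρ`-group. -/
theorem oRes_eq_bot_of_le_of_oRes {ρ : Set ℕ} {A B : Subgroup G} (h : oRes ρ A ≤ B)
    (hB : oRes ρ B = ⊥) : oRes ρ A = ⊥ := eq_bot_iff.2 ((oRes_le_oRes h).trans hB.le)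

end

/-! ### Complements of normal Hall subgroups; the r-part of an 𝔑^π-group. -/

section

variable {G : Type*} [Group G]

/-- The transfer argument behind Schur–Zassenhaus: a complement is itself a transversal of `M`, so
it stabilizes its own class in `M.QuotientDiff` and equals that stabilizer by order. Since `M`
permutes the classes transitively, the stabilizers are conjugate under `M`. -/
theorem exists_conj_eq_of_isComplement' {X : Type*} [Group X] [Finite X] {M C₁ C₂ : Subgroup X}
    [M.Normal] [IsMulCommutative M] (hM : Nat.Coprime (Nat.card M) M.index)
    (h₁ : C₁.IsComplement' M) (h₂ : C₂.IsComplement' M) :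
    ∃ m ∈ M, MulAut.conj m • C₁ = C₂ := by
  have key : ∀ C : Subgroup X, C.IsComplement' M →
      ∃ q : M.QuotientDiff, MulAction.stabilizer X q = C := by
    intro C hC
    let α : M.LeftTransversal := ⟨(C : Set X), hC⟩
    let q : M.QuotientDiff := Quotient.mk'' α
    have hle : C ≤ MulAction.stabilizer X q := by
      intro g hg
      have h : (MulOpposite.op g⁻¹) • α = α :=
        Subtype.ext (op_smul_coe_set (C.inv_mem hg))
      exact congrArg (Quotient.mk'' : M.LeftTransversal → M.QuotientDiff) h
    have h1 := (Subgroup.isComplement'_stabilizer_of_coprime (α := q) hM).symm.index_eq_card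
    have h2 := (Subgroup.isComplement'_stabilizer_of_coprime (α := q) hM).card_mul_card
    have h3 := hC.card_mul_card
    refine ⟨q, (Subgroup.eq_of_le_of_card_ge hle ?_).symm⟩
    rw [← h3, mul_comm] at h2
    exact (Nat.eq_of_mul_eq_mul_right Nat.card_pos h2).le
  obtain ⟨q₁, rfl⟩ := key C₁ h₁
  obtain ⟨q₂, rfl⟩ := key C₂ h₂
  obtain ⟨m, hm⟩ := Subgroup.exists_smul_eq hM q₁ q₂
  refine ⟨m, m.2, ?_⟩
  rw [← hm]
  exact (MulAction.stabilizer_smul_eq_stabilizer_map_conj (m : X) q₁).symm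

theorem isComplement'_subgroupOf_sup [Finite G] {C M : Subgroup G}
    (hC : C ≤ Subgroup.normalizer (M : Set G)) (h : C ⊓ M = ⊥) :
    (C.subgroupOf (C ⊔ M)).IsComplement' (M.subgroupOf (C ⊔ M)) := by
  apply Subgroup.isComplement'_of_disjoint_and_mul_eq_univ
  · rw [disjoint_iff, eq_bot_iff]
    intro x hx
    have h1 : (x : G) ∈ C ⊓ M := hx
    rw [h, Subgroup.mem_bot] at h1
    exact Subtype.ext h1
  · ext ⟨x, hx⟩
    simp only [Set.mem_univ, iff_true]
    obtain ⟨c, hc, m, hm, rfl⟩ := exists_mul_of_mem_sup hC hx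
    exact Set.mem_mul.2 ⟨⟨c, Subgroup.mem_sup_left hc⟩, hc, ⟨m, Subgroup.mem_sup_right hm⟩, hm, rfl⟩

theorem conj_map_subtype {S A B : Subgroup G} (hA : A ≤ S) (hB : B ≤ S) {m : S}
    (h : MulAut.conj m • A.subgroupOf S = B.subgroupOf S) : MulAut.conj (m : G) • A = B := by
  have h1 := congrArg (Subgroup.map S.subtype) h
  rw [Subgroup.map_subgroupOf_eq_of_le hB] at h1
  rw [← h1]
  ext x
  constructor
  · rintro ⟨a, ha, rfl⟩
    exact ⟨MulAut.conj m ⟨a, hA ha⟩, ⟨⟨a, hA ha⟩, ha, rfl⟩, rfl⟩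
  · rintro ⟨_, ⟨a, ha, rfl⟩, rfl⟩
    exact ⟨a, ha, rfl⟩

/-- Complements of an abelian normal Hall subgroup are conjugate. -/
theorem exists_conj_eq_of_abelian [Finite G] {M C₁ C₂ : Subgroup G} (hM : IsMulCommutative M)
    (h₁ : C₁ ≤ Subgroup.normalizer (M : Set G)) (h₂ : C₂ ≤ Subgroup.normalizer (M : Set G))
    (hc₁ : Nat.Coprime (Nat.card C₁) (Nat.card M)) (hc₂ : Nat.Coprime (Nat.card C₂) (Nat.card M))
    (h : C₁ ⊔ M = C₂ ⊔ M) : ∃ m ∈ M, MulAut.conj m • C₁ = C₂ := by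
  have i₁ := isComplement'_subgroupOf_sup h₁ (Subgroup.disjoint_of_coprime_natCard hc₁).eq_bot
  have i₂ := isComplement'_subgroupOf_sup h₂ (Subgroup.disjoint_of_coprime_natCard hc₂).eq_bot
  rw [← h] at i₂
  have := subgroupOf_normal_of_le (sup_le h₁ Subgroup.le_normalizer)
  have hcomm : IsMulCommutative (M.subgroupOf (C₁ ⊔ M)) :=
    Subgroup.subgroupOf_isMulCommutative _ M
  have hcard : ∀ A : Subgroup G, A ≤ C₁ ⊔ M → Nat.card (A.subgroupOf (C₁ ⊔ M)) = Nat.card A :=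
    fun A hA => Nat.card_congr (Subgroup.subgroupOfEquivOfLe hA).toEquiv
  have hcop : Nat.Coprime (Nat.card (M.subgroupOf (C₁ ⊔ M))) (M.subgroupOf (C₁ ⊔ M)).index := by
    rw [i₁.index_eq_card, hcard _ le_sup_left, hcard _ le_sup_right]
    exact hc₁.symm
  obtain ⟨m, hm, hm'⟩ := exists_conj_eq_of_isComplement' hcop i₁ i₂
  exact ⟨m, hm, conj_map_subtype le_sup_left (h ▸ le_sup_left) hm'⟩

/-- Existence of complements of a normal Hall subgroup. -/
theorem exists_complement_of_oRes [Finite G] {r s : Set ℕ} {M S : Subgroup G} (hMS : M ≤ S)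
    (hS : S ≤ Subgroup.normalizer (M : Set G)) (hM : oRes r M = ⊥) (hSM : oRes s S ≤ M)
    (hrs : ∀ p, p ∈ r → p ∉ s) : ∃ C ≤ S, C ⊔ M = S ∧ C ⊓ M = ⊥ ∧ oRes s C = ⊥ := by
  have := subgroupOf_normal_of_le hS
  have hcop : Nat.Coprime (Nat.card (M.subgroupOf S)) (M.subgroupOf S).index := by
    rw [Nat.card_congr (Subgroup.subgroupOfEquivOfLe hMS).toEquiv]
    have h1 : oRes s (⊤ : Subgroup (S ⧸ M.subgroupOf S)) = ⊥ := by
      rw [← Subgroup.map_top_of_surjective _ (QuotientGroup.mk'_surjective (M.subgroupOf S)),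
        oRes_map_eq_bot, QuotientGroup.ker_mk', ← Subgroup.map_le_map_iff_of_injective
        S.subtype_injective, oRes_map_subtype_top, Subgroup.map_subgroupOf_eq_of_le hMS]
      exact hSM
    rw [oRes_eq_bot_iff_card] at h1 hM
    rw [Subgroup.card_top] at h1
    exact Nat.coprime_of_dvd fun p hp h2 h3 => hrs p (hM p hp h2) (h1 p hp h3)
  obtain ⟨C, hC⟩ := Subgroup.exists_left_complement'_of_coprime hcop
  have e1 : C.map S.subtype ⊔ M = S := by
    have := congrArg (Subgroup.map S.subtype) hC.sup_eq_top
    rwa [Subgroup.map_sup, Subgroup.map_subgroupOf_eq_of_le hMS, ← MonoidHom.range_eq_map,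
      Subgroup.range_subtype] at this
  have e2 : C.map S.subtype ⊓ M = ⊥ := by
    have := congrArg (Subgroup.map S.subtype) hC.disjoint.eq_bot
    rwa [Subgroup.map_inf _ _ _ S.subtype_injective, Subgroup.map_subgroupOf_eq_of_le hMS,
      Subgroup.map_bot] at this
  have e3 : C.map S.subtype ≤ S := Subgroup.map_subtype_le C
  refine ⟨_, e3, e1, e2, eq_bot_iff.2 ?_⟩
  rw [← e2]
  exact le_inf (oRes_le _ _) ((oRes_mono e3).trans hSM)

theorem oRes_conj_eq_bot [Finite G] {ρ : Set ℕ} {T : Subgroup G} (g : G) (h : oRes ρ T = ⊥) :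
    oRes ρ (MulAut.conj g • T) = ⊥ := by
  rw [oRes_conj, h, Subgroup.smul_bot]

theorem cRes_conj_eq_bot [Finite G] {ρ : Set ℕ} {T : Subgroup G} (g : G) (h : cRes ρ T = ⊥) :
    cRes ρ (MulAut.conj g • T) = ⊥ := by
  rw [cRes_conj, h, Subgroup.smul_bot]

/-- If the `p`-elements with `p ∈ r` commute with the `q`-elements with `q ∉ r`, the former
generate an `r`-group. -/
theorem oRes_oRes_compl_eq_bot [Finite G] {r : Set ℕ} {T : Subgroup G}
    (h : ∀ p q : ℕ, p.Prime → q.Prime → p ∈ r → q ∉ r → ∀ x ∈ T, ∀ y ∈ T,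
      IsPElement p x → IsPElement q y → Commute x y) : oRes r (oRes rᶜ T) = ⊥ := by
  set E := oRes rᶜ T with hE
  set D := oRes r E with hD
  have hET : E ≤ T := oRes_le _ _
  have hDE : D ≤ E := oRes_le _ _
  -- `D` is central in `E`: generators of `E` are `r`-elements and those of `D` are `r'`-elements,
  -- all inside `T`.
  have hcent : ∀ x ∈ E, ∀ y ∈ D, Commute x y := by
    have h1 : E ≤ Subgroup.centralizer (D : Set G) := by
      rw [hE, oRes_le_iff]
      intro x hx p hp hpr hxp
      rw [Subgroup.mem_centralizer_iff]
      have h2 : D ≤ Subgroup.centralizer {x} := by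
        rw [hD, oRes_le_iff]
        intro y hy q hq hqr hyq
        rw [Subgroup.mem_centralizer_singleton_iff]
        exact (h p q hp hq (not_not.1 hpr) hqr x hx y (hET hy) hxp hyq).symm
      intro y hy
      exact Subgroup.mem_centralizer_singleton_iff.1 (h2 hy)
    intro x hx y hy
    exact (Subgroup.mem_centralizer_iff.1 (h1 hx) y hy).symm
  -- As `D` is abelian, a product of elements of orders prime to `r` again has such an exponent, so
  -- `D` is an `r'`-group.
  have hDr : oRes rᶜ D = ⊥ := by
    have h1 : ∀ x ∈ D, ∃ n : ℕ, x ^ n = 1 ∧ ∀ p : ℕ, p.Prime → p ∈ r → ¬ p ∣ n := by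
      intro x hx
      rw [hD, oRes] at hx
      induction hx using Subgroup.closure_induction with
      | mem x hx =>
        obtain ⟨_, q, hq, hqr, k, hk⟩ := hx
        refine ⟨q ^ k, hk, fun p hp hpr hd => hqr ?_⟩
        rwa [← (Nat.prime_dvd_prime_iff_eq hp hq).1 (hp.dvd_of_dvd_pow hd)]
      | one => exact ⟨1, one_pow 1, fun p hp _ hd => hp.one_lt.ne' (Nat.dvd_one.1 hd)⟩
      | mul x y hx hy ihx ihy =>
        obtain ⟨n, hn, hn'⟩ := ihx
        obtain ⟨m, hm, hm'⟩ := ihy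
        refine ⟨n * m, ?_, fun p hp hpr hd => ?_⟩
        · rw [(hcent x (hDE hx) y hy).mul_pow, pow_mul, hn, one_pow, mul_comm n, pow_mul, hm,
            one_pow, one_mul]
        · exact (hp.dvd_mul.1 hd).elim (hn' p hp hpr) (hm' p hp hpr)
      | inv x _ ih =>
        obtain ⟨n, hn, hn'⟩ := ih
        exact ⟨n, by rw [inv_pow, hn, inv_one], hn'⟩
    rw [oRes_eq_bot_iff]
    rintro x hx p hp hpr ⟨k, hk⟩
    obtain ⟨n, hn, hn'⟩ := h1 x hx
    have hc : Nat.Coprime (p ^ k) n :=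
      ((Nat.Prime.coprime_iff_not_dvd hp).2 (hn' p hp (not_not.1 hpr))).pow_left k
    rw [← orderOf_eq_one_iff]
    exact Nat.dvd_one.1 (hc ▸ Nat.dvd_gcd (orderOf_dvd_of_pow_eq_one hk)
      (orderOf_dvd_of_pow_eq_one hn))
  have hEN : E ≤ Subgroup.normalizer (D : Set G) := le_normalizer_oRes r E
  obtain ⟨C, hCE, hCD, hCD', hC⟩ := exists_complement_of_oRes hDE hEN hDr (le_refl (oRes r E))
    (fun p hp => hp)
  have hDC : D ≤ Subgroup.normalizer (C : Set G) := by
    intro d hd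
    rw [Subgroup.mem_normalizer_iff]
    intro c
    by_cases hc : c ∈ E
    · have := (hcent c hc d hd).eq
      rw [← this, mul_inv_cancel_right]
    · refine ⟨fun h => absurd (hCE h) hc, fun h => absurd ?_ hc⟩
      have := E.mul_mem (E.mul_mem (E.inv_mem (hDE hd)) (hCE h)) (hDE hd)
      simpa [mul_assoc] using this
  -- Now `E = D × C`; since `E` is generated by `r`-elements, it is contained in the `r`-group `C`.
  have hE1 : E ≤ C := by
    have h1 : E ≤ oRes rᶜ E := oRes_le_oRes le_rfl
    have h2 : oRes rᶜ E ≤ oRes rᶜ D ⊔ C := by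
      have := oRes_sup_le rᶜ hDC
      rwa [sup_comm D C, hCD] at this
    rw [hDr, bot_sup_eq] at h2
    exact h1.trans h2
  exact eq_bot_iff.2 ((oRes_mono hE1).trans hC.le)

theorem le_oRes_sup_oRes_compl [Finite G] (r : Set ℕ) (T : Subgroup G) :
    T ≤ oRes r T ⊔ oRes rᶜ T := by
  refine le_of_pElements fun x hx p hp hxp => ?_
  by_cases hpr : p ∈ r
  · exact Subgroup.mem_sup_right (mem_oRes hx hp (fun h => h hpr) hxp)
  · exact Subgroup.mem_sup_left (mem_oRes hx hp hpr hxp)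

theorem oRes_sup_oRes_compl [Finite G] (r : Set ℕ) (T : Subgroup G) :
    oRes r T ⊔ oRes rᶜ T = T :=
  le_antisymm (sup_le (oRes_le _ _) (oRes_le _ _)) (le_oRes_sup_oRes_compl r T)

theorem oRes_commute [Finite G] {r : Set ℕ} {T : Subgroup G}
    (h : ∀ p q : ℕ, p.Prime → q.Prime → p ∈ r → q ∉ r → ∀ x ∈ T, ∀ y ∈ T,
      IsPElement p x → IsPElement q y → Commute x y) :
    oRes rᶜ T ≤ Subgroup.centralizer (oRes r T : Set G) := by
  rw [oRes_le_iff]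
  intro x hx p hp hpr hxp
  have h2 : oRes r T ≤ Subgroup.centralizer {x} := by
    rw [oRes_le_iff]
    intro y hy q hq hqr hyq
    rw [Subgroup.mem_centralizer_singleton_iff]
    exact (h p q hp hq (not_not.1 hpr) hqr x hx y hy hxp hyq).symm
  rw [Subgroup.mem_centralizer_iff]
  exact fun y hy => Subgroup.mem_centralizer_singleton_iff.1 (h2 hy)

/-- In an `𝔑^π`-group, `r`-elements commute with `r'`-elements if `r = π` or `r = {p}`, `p ∉ π`. -/
theorem commute_of_cRes {π r : Set ℕ} (hr : r = π ∨ ∃ p, p ∉ π ∧ r = {p}) {T : Subgroup G}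
    (hT : cRes π T = ⊥) : ∀ p q : ℕ, p.Prime → q.Prime → p ∈ r → q ∉ r → ∀ x ∈ T, ∀ y ∈ T,
      IsPElement p x → IsPElement q y → Commute x y := by
  intro p q hp hq hpr hqr x hx y hy hxp hyq
  refine commute_of_cRes_eq_bot hT hp hq (fun h => hqr (h ▸ hpr)) ?_ hx hy hxp hyq
  rcases hr with rfl | ⟨s, hs, rfl⟩
  · exact fun _ => hqr
  · intro h
    exact absurd ((Set.mem_singleton_iff.1 hpr) ▸ h) hs

theorem compl_commute {r : Set ℕ} {T : Subgroup G}
    (h : ∀ p q : ℕ, p.Prime → q.Prime → p ∈ r → q ∉ r → ∀ x ∈ T, ∀ y ∈ T,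
      IsPElement p x → IsPElement q y → Commute x y) :
    ∀ p q : ℕ, p.Prime → q.Prime → p ∈ rᶜ → q ∉ rᶜ → ∀ x ∈ T, ∀ y ∈ T,
      IsPElement p x → IsPElement q y → Commute x y :=
  fun p q hp hq hpr hqr x hx y hy hxp hyq =>
    (h q p hq hp (not_not.1 hqr) hpr y hy x hx hyq hxp).symm

end

/-! ### Conjugacy of nilpotent Hall complements. -/

section

variable {G : Type*} [Group G]

theorem oRes_anti {r s : Set ℕ} (h : r ⊆ s) (T : Subgroup G) : oRes s T ≤ oRes r T :=
  oRes_le_iff.2 fun _ hx _ hp hps hxp => mem_oRes hx hp (fun hr => hps (h hr)) hxp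

theorem oRes_eq_bot_of_subset {r s : Set ℕ} (h : r ⊆ s) {T : Subgroup G} (hT : oRes r T = ⊥) :
    oRes s T = ⊥ := eq_bot_iff.2 ((oRes_anti h T).trans hT.le)

theorem card_conj_smul (g : G) (T : Subgroup G) :
    Nat.card (MulAut.conj g • T : Subgroup G) = Nat.card T :=
  (Nat.card_congr (Subgroup.equivSMul (MulAut.conj g) T).toEquiv).symm

theorem isPGroup_of_oRes [Finite G] {p : ℕ} {R : Subgroup G}
    (h : oRes {p} R = ⊥) : IsPGroup p R := by
  rw [oRes_eq_bot_iff_card] at h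
  refine IsPGroup.of_card (n := (Nat.card R).primeFactorsList.length) ?_
  exact Nat.eq_prime_pow_of_unique_prime_dvd Nat.card_pos.ne' (fun hd hd' => h _ hd hd')

/-- Complementary `p`-subgroups of a normal `p'`-subgroup are conjugate. -/
theorem exists_conj_eq_of_oRes_singleton [Finite G] {p : ℕ} (hp : p.Prime) {N R₁ R₂ : Subgroup G}
    (hN : oRes {p}ᶜ N = ⊥) (h₁ : oRes {p} R₁ = ⊥) (h₂ : oRes {p} R₂ = ⊥)
    (hn₁ : R₁ ≤ Subgroup.normalizer (N : Set G)) (hn₂ : R₂ ≤ Subgroup.normalizer (N : Set G))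
    (h : R₁ ⊔ N = R₂ ⊔ N) : ∃ x ∈ R₁ ⊔ N, MulAut.conj x • R₁ = R₂ := by
  have := Fact.mk hp
  have key : ∀ R : Subgroup G, oRes {p} R = ⊥ → R ≤ Subgroup.normalizer (N : Set G) →
      R ⊔ N = R₁ ⊔ N → ∃ P : Sylow p ↥(R₁ ⊔ N), (P : Subgroup ↥(R₁ ⊔ N)) =
        R.subgroupOf (R₁ ⊔ N) := by
    intro R hR hRN hRe
    have i := isComplement'_subgroupOf_sup hRN
      (inf_eq_bot_of_oRes hR hN (fun q hq hq' => hq' hq))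
    rw [hRe] at i
    have h1 : IsPGroup p (R.subgroupOf (R₁ ⊔ N)) :=
      (isPGroup_of_oRes hR).of_equiv (Subgroup.subgroupOfEquivOfLe (hRe ▸ le_sup_left)).symm
    refine ⟨h1.toSylow ?_, rfl⟩
    rw [i.symm.index_eq_card, Nat.card_congr (Subgroup.subgroupOfEquivOfLe le_sup_right).toEquiv]
    intro hd
    exact (oRes_eq_bot_iff_card.1 hN) p hp hd rfl
  obtain ⟨P₁, hP₁⟩ := key R₁ h₁ hn₁ rfl
  obtain ⟨P₂, hP₂⟩ := key R₂ h₂ hn₂ h.symm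
  obtain ⟨x, hx⟩ := MulAction.exists_smul_eq ↥(R₁ ⊔ N) P₁ P₂
  refine ⟨x, x.2, conj_map_subtype le_sup_left (h ▸ le_sup_left) ?_⟩
  rw [← hP₁, ← hP₂, ← hx]
  rfl

theorem conj_sup_eq_of_mem {C M : Subgroup G} {m : G} (hm : m ∈ M) :
    MulAut.conj m • C ⊔ M = C ⊔ M := by
  have h1 : MulAut.conj m • (C ⊔ M) = C ⊔ M :=
    Subgroup.conj_smul_eq_self_of_mem (Subgroup.mem_sup_right hm)
  rwa [Subgroup.smul_sup, Subgroup.conj_smul_eq_self_of_mem hm] at h1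

/-- Nilpotent complements of a normal Hall subgroup are conjugate. -/
theorem exists_conj_eq_of_nilpotent [Finite G] {r : Set ℕ} {M C₁ C₂ : Subgroup G}
    (hM : oRes r M = ⊥) (h₁ : oRes rᶜ C₁ = ⊥) (h₂ : oRes rᶜ C₂ = ⊥)
    (hc₁ : cRes ∅ C₁ = ⊥) (hc₂ : cRes ∅ C₂ = ⊥)
    (hn₁ : C₁ ≤ Subgroup.normalizer (M : Set G)) (hn₂ : C₂ ≤ Subgroup.normalizer (M : Set G))
    (h : C₁ ⊔ M = C₂ ⊔ M) : ∃ m ∈ M, MulAut.conj m • C₁ = C₂ := by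
  obtain ⟨n, hn⟩ : ∃ n, Nat.card C₁ < n := ⟨_, Nat.lt_succ_self _⟩
  induction n generalizing M C₁ C₂ with
  | zero => exact absurd hn (Nat.not_lt_zero _)
  | succ n ih =>
    have hd₂ : C₂ ⊓ M = ⊥ := inf_eq_bot_of_oRes h₂ hM fun q hq hq' => hq hq'
    by_cases hC : C₁ = ⊥
    · refine ⟨1, M.one_mem, ?_⟩
      have h3 : C₂ ≤ M := by
        rw [hC, bot_sup_eq] at h
        exact h ▸ le_sup_left
      rw [inf_eq_left.2 h3] at hd₂
      rw [hC, hd₂, Subgroup.smul_bot]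
    have hne : Nat.card C₁ ≠ 1 := fun h => hC (Subgroup.card_eq_one.1 h)
    obtain ⟨p, hp, hpd⟩ := Nat.exists_prime_and_dvd hne
    have hpr : p ∉ r := (oRes_eq_bot_iff_card.1 h₁) p hp hpd
    have hcomm : ∀ C : Subgroup G, cRes ∅ C = ⊥ → _ := fun C hC =>
      commute_of_cRes (r := {p}) (Or.inr ⟨p, Set.notMem_empty p, rfl⟩) hC
    -- A nilpotent `C` is the product of its Sylow `p`-subgroup `oRes {p}ᶜ C` and its Hall
    -- `p'`-subgroup `oRes {p} C`.
    have hR : ∀ C : Subgroup G, cRes ∅ C = ⊥ → oRes {p} (oRes {p}ᶜ C) = ⊥ := fun C hC =>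
      oRes_oRes_compl_eq_bot (hcomm C hC)
    have hS : ∀ C : Subgroup G, cRes ∅ C = ⊥ → oRes {p}ᶜ (oRes {p} C) = ⊥ := fun C hC => by
      have := oRes_oRes_compl_eq_bot (compl_commute (hcomm C hC))
      rwa [compl_compl] at this
    have hrp : r ⊆ {p}ᶜ := by
      rintro q hq rfl
      exact hpr hq
    have hMp : oRes {p}ᶜ M = ⊥ := oRes_eq_bot_of_subset hrp hM
    have hNle : ∀ A B : Subgroup G, A ≤ Subgroup.normalizer (M : Set G) → B ⊔ M = A ⊔ M →
        oRes {p} B ≤ oRes {p} A ⊔ M := fun A B hA hBA =>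
      ((oRes_mono le_sup_left).trans (congrArg (oRes {p}) hBA).le).trans (oRes_sup_le _ hA)
    have hNeq : oRes {p} C₁ ⊔ M = oRes {p} C₂ ⊔ M :=
      le_antisymm (sup_le (hNle _ _ hn₂ h) le_sup_right)
        (sup_le (hNle _ _ hn₁ h.symm) le_sup_right)
    have hNp : oRes {p}ᶜ (oRes {p} C₁ ⊔ M) = ⊥ := by
      refine oRes_eq_bot_of_le_of_oRes (B := M) ?_ hMp
      have := oRes_sup_le {p}ᶜ ((oRes_le {p} C₁).trans hn₁)
      rwa [hS C₁ hc₁, bot_sup_eq] at this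
    have hRN : ∀ C : Subgroup G, C ≤ Subgroup.normalizer (M : Set G) →
        oRes {p}ᶜ C ≤ Subgroup.normalizer ((oRes {p} C ⊔ M : Subgroup G) : Set G) := fun C hC =>
      (oRes_le _ _).trans (le_normalizer_sup (le_normalizer_oRes _ _) hC)
    have hsup : ∀ C : Subgroup G, oRes {p}ᶜ C ⊔ (oRes {p} C ⊔ M) = C ⊔ M := fun C => by
      rw [← sup_assoc, sup_comm (oRes {p}ᶜ C), oRes_sup_oRes_compl]
    -- Sylow's theorem in `C₁M` makes the `p`-parts conjugate. Since `C₁` normalizes its own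
    -- `p`-part, the conjugating element may be taken in `M`.
    obtain ⟨x, hx, hxR⟩ := exists_conj_eq_of_oRes_singleton hp hNp (hR C₁ hc₁) (hR C₂ hc₂)
      (hRN C₁ hn₁) (hNeq ▸ hRN C₂ hn₂) (by rw [hsup, hNeq, hsup, h])
    rw [hsup] at hx
    obtain ⟨c, hc, m, hm, hcm⟩ := exists_mul_of_mem_sup hn₁ (Subgroup.inv_mem _ hx)
    have hxe : x = m⁻¹ * c⁻¹ := by rw [← mul_inv_rev, hcm, inv_inv]
    have hm' : m⁻¹ ∈ M := M.inv_mem hm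
    have hRe : oRes {p}ᶜ (MulAut.conj m⁻¹ • C₁) = oRes {p}ᶜ C₂ := by
      rw [oRes_conj, ← hxR, hxe, map_mul, mul_smul]
      congr 1
      exact (mem_normalizer_iff_conj_smul.1 (le_normalizer_oRes _ _ (C₁.inv_mem hc))).symm
    set C := MulAut.conj m⁻¹ • C₁ with hCdef
    have hCM : C ⊔ M = C₂ ⊔ M := (conj_sup_eq_of_mem hm').trans h
    have hnC : C ≤ Subgroup.normalizer (M : Set G) :=
      (le_sup_left.trans hCM.le).trans (sup_le hn₂ Subgroup.le_normalizer)
    have hcC : cRes ∅ C = ⊥ := cRes_conj_eq_bot _ hc₁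
    have h₁C : oRes rᶜ C = ⊥ := oRes_conj_eq_bot _ h₁
    have hcent : ∀ D : Subgroup G, cRes ∅ D = ⊥ →
        oRes {p} D ≤ Subgroup.centralizer (oRes {p}ᶜ D : Set G) := fun D hD => by
      have := oRes_commute (compl_commute (hcomm D hD))
      rwa [compl_compl] at this
    set R := oRes {p}ᶜ C₂ with hRdef
    -- With a common `p`-part `R`, both `p'`-parts centralize `R`, so they complement `M ∩ C(R)` in
    -- the same group. The inductive conjugator lies in `M ∩ C(R)` and so keeps `R` fixed.
    set M' := M ⊓ Subgroup.centralizer (R : Set G) with hM'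
    have hcC' : oRes {p} C ≤ Subgroup.centralizer (R : Set G) := hRe ▸ hcent C hcC
    have hcC₂ : oRes {p} C₂ ≤ Subgroup.centralizer (R : Set G) := hcent C₂ hc₂
    have hnor : ∀ A : Subgroup G, A ≤ Subgroup.normalizer (M : Set G) →
        A ≤ Subgroup.centralizer (R : Set G) → A ≤ Subgroup.normalizer (M' : Set G) :=
      fun A h1 h2 => le_normalizer_inf h1 (h2.trans Subgroup.le_normalizer)
    have hle : ∀ A B : Subgroup G, A ≤ Subgroup.normalizer (M : Set G) →
        A ≤ Subgroup.centralizer (R : Set G) → B ≤ Subgroup.centralizer (R : Set G) →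
        B ≤ A ⊔ M → B ≤ A ⊔ M' := by
      intro A B hAM hA hB hBA b hb
      obtain ⟨a, ha, m, hm, rfl⟩ := exists_mul_of_mem_sup hAM (hBA hb)
      refine Subgroup.mul_mem_sup ha ⟨hm, ?_⟩
      have := Subgroup.mul_mem _ (Subgroup.inv_mem _ (hA ha)) (hB hb)
      rwa [inv_mul_cancel_left] at this
    have hSM : oRes {p} C ⊔ M = oRes {p} C₂ ⊔ M :=
      le_antisymm (sup_le (hNle _ _ hn₂ hCM) le_sup_right)
        (sup_le (hNle _ _ hnC hCM.symm) le_sup_right)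
    have hSn : oRes {p} C ≤ Subgroup.normalizer (M : Set G) := (oRes_le _ _).trans hnC
    have hSn₂ : oRes {p} C₂ ≤ Subgroup.normalizer (M : Set G) := (oRes_le _ _).trans hn₂
    have hcard : Nat.card (oRes {p} C) < n := by
      have h1 : Nat.card C = Nat.card C₁ := card_conj_smul _ _
      have h2 : oRes {p} C < C := by
        refine lt_of_le_of_ne (oRes_le _ _) fun he => ?_
        have := oRes_eq_bot_iff_card.1 (he ▸ hS C hcC) p hp (h1 ▸ hpd)
        exact this rfl
      have h3 : Nat.card (oRes {p} C) < Nat.card C := by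
        refine lt_of_le_of_ne (Subgroup.card_le_of_le h2.le) fun he => h2.ne ?_
        exact Subgroup.eq_of_le_of_card_ge h2.le he.ge
      lia
    obtain ⟨l, hl, hlS⟩ := ih (M := M') (C₁ := oRes {p} C) (C₂ := oRes {p} C₂)
      (oRes_eq_bot_of_le inf_le_left hM) (oRes_eq_bot_of_le (oRes_le _ _) h₁C)
      (oRes_eq_bot_of_le (oRes_le _ _) h₂) (cRes_eq_bot_of_le (oRes_le _ _) hcC)
      (cRes_eq_bot_of_le (oRes_le _ _) hc₂) (hnor _ hSn hcC') (hnor _ hSn₂ hcC₂)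
      (le_antisymm (sup_le (hle _ _ hSn₂ hcC₂ hcC' (hSM ▸ le_sup_left)) le_sup_right)
        (sup_le (hle _ _ hSn hcC' hcC₂ (hSM ▸ le_sup_left)) le_sup_right)) hcard
    refine ⟨l * m⁻¹, M.mul_mem hl.1 hm', ?_⟩
    rw [map_mul, mul_smul, ← hCdef, ← oRes_sup_oRes_compl {p} C, Subgroup.smul_sup, hlS, hRe]
    have hlR : MulAut.conj l • R = R := by
      refine mem_normalizer_iff_conj_smul.1 ?_
      exact Subgroup.centralizer_le_normalizer _ hl.2
    rw [hlR, hRdef, oRes_sup_oRes_compl]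

end

/-! ### Series with π-factors and p-factors, and the passage from composition series. -/

/-- `r` is one of the components of `𝔑^π`: either `π` itself or a singleton outside `π`. -/
def IsComponent (π r : Set ℕ) : Prop := r = π ∨ ∃ p, p ∉ π ∧ r = {p}

/-- `A` is normal in `B` and `B/A` is a `π`-group or a `p`-group with `p ∉ π`. -/
def SolStep {G : Type*} [Group G] (π : Set ℕ) (A B : Subgroup G) : Prop :=
  A ≤ B ∧ B ≤ Subgroup.normalizer (A : Set G) ∧ ∃ r, IsComponent π r ∧ oRes r B ≤ A

/-- `T` has a subnormal series whose factors are `π`-groups or `p`-groups with `p ∉ π`. -/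
def HasSolSeries {G : Type*} [Group G] (π : Set ℕ) (T : Subgroup G) : Prop :=
  Relation.ReflTransGen (SolStep π) ⊥ T

/-- `A` is normal in `B` with simple quotient. -/
def SimpleStep {G : Type*} [Group G] (A B : Subgroup G) : Prop :=
  A ≤ B ∧ ∃ _ : (A.subgroupOf B).Normal, IsSimpleGroup (B ⧸ A.subgroupOf B)

section

variable {G G' : Type*} [Group G] [Group G']

theorem HasSolSeries.map [Finite G] {π : Set ℕ} {T : Subgroup G} (h : HasSolSeries π T)
    (f : G →* G') : HasSolSeries π (T.map f) := by
  have : Relation.ReflTransGen (SolStep π) (Subgroup.map f ⊥) (Subgroup.map f T) :=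
    Relation.ReflTransGen.lift (r := SolStep π) (p := SolStep π) (Subgroup.map f) (fun A B hAB => by
    obtain ⟨h1, h2, r, hr, h3⟩ := hAB
    refine ⟨Subgroup.map_mono h1, (Subgroup.map_mono h2).trans (Subgroup.le_normalizer_map f),
      r, hr, ?_⟩
    rw [← oRes_map]
    exact Subgroup.map_mono h3) _ _ h
  rwa [Subgroup.map_bot] at this

theorem HasSolSeries.comap {π : Set ℕ} {T : Subgroup G} (h : HasSolSeries π T)
    {f : G' →* G} (hf : Function.Injective f) : HasSolSeries π (T.comap f) := by
  have : Relation.ReflTransGen (SolStep π) (Subgroup.comap f ⊥) (Subgroup.comap f T) :=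
    Relation.ReflTransGen.lift (r := SolStep π) (p := SolStep π) (Subgroup.comap f) (fun A B hAB => by
    obtain ⟨h1, h2, r, hr, h3⟩ := hAB
    refine ⟨Subgroup.comap_mono h1,
      (Subgroup.comap_mono h2).trans (Subgroup.le_normalizer_comap f), r, hr, ?_⟩
    rw [oRes_le_iff] at h3 ⊢
    exact fun x hx p hp hpr hxp => h3 (f x) hx p hp hpr (hxp.map f)) _ _ h
  rwa [(MonoidHom.comap_bot f).trans ((MonoidHom.ker_eq_bot_iff f).2 hf)] at this

theorem HasSolSeries.subtype_top {π : Set ℕ} (h : HasSolSeries π (⊤ : Subgroup G))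
    (S : Subgroup G) : HasSolSeries π (⊤ : Subgroup S) := by
  simpa using h.comap S.subtype_injective

theorem HasSolSeries.quotient_top [Finite G] {π : Set ℕ} (h : HasSolSeries π (⊤ : Subgroup G))
    (N : Subgroup G) [N.Normal] : HasSolSeries π (⊤ : Subgroup (G ⧸ N)) := by
  have := h.map (QuotientGroup.mk' N)
  rwa [Subgroup.map_top_of_surjective _ (QuotientGroup.mk'_surjective N)] at this

theorem mem_normalizer_of_conj_smul_le [Finite G] {M : Subgroup G} {g : G}
    (h : MulAut.conj g • M ≤ M) : g ∈ Subgroup.normalizer (M : Set G) :=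
  mem_normalizer_iff_conj_smul.2 (Subgroup.eq_of_le_of_card_ge h (card_conj_smul g M).ge)

theorem conj_smul_le_normalizer_iff {A M : Subgroup G} {g : G} :
    MulAut.conj g • A ≤ Subgroup.normalizer ((MulAut.conj g • M : Subgroup G) : Set G) ↔
      A ≤ Subgroup.normalizer (M : Set G) := by
  have h1 : MulAut.conj g • Subgroup.normalizer (M : Set G) =
      Subgroup.normalizer ((MulAut.conj g • M : Subgroup G) : Set G) :=
    Subgroup.map_equiv_normalizer_eq M (MulAut.conj g)
  rw [← h1, Subgroup.pointwise_smul_le_pointwise_smul_iff]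

/-- Climb the series. A maximal nontrivial normal `r`-subgroup of `A` absorbs its conjugates under
`B`, because the product of two normal `r`-subgroups is one again; so it is normalized by `B`. -/
theorem exists_normal_of_hasSolSeries [Finite G] {π : Set ℕ} {T : Subgroup G}
    (h : HasSolSeries π T) (hT : T ≠ ⊥) : ∃ r, IsComponent π r ∧ ∃ M ≤ T, M ≠ ⊥ ∧
      T ≤ Subgroup.normalizer (M : Set G) ∧ oRes r M = ⊥ := by
  induction h with
  | refl => exact absurd rfl hT
  | @tail A B _ hAB ih =>
    obtain ⟨h1, h2, r, hr, h3⟩ := hAB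
    by_cases hA : A = ⊥
    · subst hA
      exact ⟨r, hr, B, le_rfl, hT, Subgroup.le_normalizer, eq_bot_iff.2 h3⟩
    obtain ⟨r, hr, M, hM⟩ := ih hA
    obtain ⟨M', hMM', hM'⟩ := (Set.toFinite {M : Subgroup G | M ≤ A ∧ M ≠ ⊥ ∧
      A ≤ Subgroup.normalizer (M : Set G) ∧ oRes r M = ⊥}).exists_le_maximal hM
    obtain ⟨hM1, hM2, hM3, hM4⟩ := hM'.prop
    refine ⟨r, hr, M', hM1.trans h1, hM2, fun b hb => mem_normalizer_of_conj_smul_le ?_, hM4⟩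
    have hbA := mem_normalizer_iff_conj_smul.1 (h2 hb)
    have hb1 : MulAut.conj b • M' ≤ A :=
      (Subgroup.pointwise_smul_le_pointwise_smul_iff.2 hM1).trans hbA.le
    have hb2 : A ≤ Subgroup.normalizer ((MulAut.conj b • M' : Subgroup G) : Set G) := by
      have := conj_smul_le_normalizer_iff (g := b).2 hM3
      rwa [hbA] at this
    have hsup : MulAut.conj b • M' ⊔ M' ∈ {M : Subgroup G | M ≤ A ∧ M ≠ ⊥ ∧
        A ≤ Subgroup.normalizer (M : Set G) ∧ oRes r M = ⊥} := by
      refine ⟨sup_le hb1 hM1, fun h => hM2 (eq_bot_iff.2 (h ▸ le_sup_right)),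
        le_normalizer_sup hb2 hM3, oRes_eq_bot_of_le_of_oRes (B := M') ?_ hM4⟩
      have := oRes_sup_le r (hb1.trans hM3)
      rwa [oRes_conj_eq_bot _ hM4, bot_sup_eq] at this
    exact le_sup_left.trans (hM'.2 hsup le_sup_right)

/-- A nontrivial group with such a series has a nontrivial normal subgroup that is a `π`-group or
an abelian `p`-group with `p ∉ π`. -/
theorem exists_normal_of_hasSolSeries_top [Finite G] [Nontrivial G] {π : Set ℕ}
    (h : HasSolSeries π (⊤ : Subgroup G)) : ∃ r, IsComponent π r ∧ ∃ M : Subgroup G, M ≠ ⊥ ∧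
      M.Normal ∧ oRes r M = ⊥ ∧ (r = π ∨ IsMulCommutative M) := by
  obtain ⟨r, hr, M, -, hM, hn, ho⟩ := exists_normal_of_hasSolSeries h bot_ne_top.symm
  have hMn : M.Normal := Subgroup.normalizer_eq_top_iff.1 (top_le_iff.1 hn)
  rcases id hr with hrπ | ⟨p, hpπ, rfl⟩
  · exact ⟨r, hr, M, hM, hMn, ho, Or.inl hrπ⟩
  have hp : p.Prime := by
    have hne : Nat.card M ≠ 1 := fun h => hM (Subgroup.card_eq_one.1 h)
    obtain ⟨q, hq, hqd⟩ := Nat.exists_prime_and_dvd hne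
    rwa [← Set.mem_singleton_iff.1 (oRes_eq_bot_iff_card.1 ho q hq hqd)]
  have := Fact.mk hp
  have hMt : Nontrivial M := (Subgroup.nontrivial_iff_ne_bot M).2 hM
  -- The centre of a nontrivial `p`-group is nontrivial, abelian and characteristic.
  have hc := (isPGroup_of_oRes ho).center_nontrivial
  refine ⟨{p}, hr, (Subgroup.center M).map M.subtype, ?_, inferInstance,
    oRes_eq_bot_of_le (Subgroup.map_subtype_le _) ho, Or.inr inferInstance⟩
  rw [Ne, Subgroup.map_eq_bot_iff_of_injective _ M.subtype_injective]
  exact (Subgroup.nontrivial_iff_ne_bot _).1 hc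

theorem oRes_top_quotient_eq_bot_iff [Finite G] {r : Set ℕ} {A B : Subgroup G} (hAB : A ≤ B)
    [(A.subgroupOf B).Normal] :
    oRes r (⊤ : Subgroup (B ⧸ A.subgroupOf B)) = ⊥ ↔ oRes r B ≤ A := by
  rw [← Subgroup.map_top_of_surjective _ (QuotientGroup.mk'_surjective (A.subgroupOf B)),
    oRes_map_eq_bot, QuotientGroup.ker_mk', ← Subgroup.map_le_map_iff_of_injective
    B.subtype_injective, oRes_map_subtype_top, Subgroup.map_subgroupOf_eq_of_le hAB]

theorem exists_simpleStep [Finite G] {B : Subgroup G} (hB : B ≠ ⊥) :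
    ∃ A < B, SimpleStep A B := by
  obtain ⟨A, hA⟩ := (Set.toFinite {A : Subgroup G | A < B ∧
    B ≤ Subgroup.normalizer (A : Set G)}).exists_maximal
      ⟨⊥, bot_lt_iff_ne_bot.2 hB, by rw [Subgroup.normalizer_eq_top]; exact le_top⟩
  obtain ⟨⟨hAB, hn⟩, hmax⟩ := hA
  have hN := subgroupOf_normal_of_le hn
  refine ⟨A, hAB, hAB.le, hN, ?_⟩
  have hnt : Nontrivial (B ⧸ A.subgroupOf B) := by
    rw [QuotientGroup.nontrivial_iff]
    intro h
    exact hAB.not_ge (Subgroup.subgroupOf_eq_top.1 h)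
  refine ⟨fun H hH => ?_⟩
  set C := (H.comap (QuotientGroup.mk' (A.subgroupOf B))).map B.subtype with hC
  have hCB : C ≤ B := Subgroup.map_subtype_le _
  have hCs : C.subgroupOf B = H.comap (QuotientGroup.mk' (A.subgroupOf B)) :=
    Subgroup.comap_map_eq_self_of_injective B.subtype_injective _
  have hAC : A ≤ C := by
    have : A.subgroupOf B ≤ C.subgroupOf B := by
      rw [hCs]
      intro x hx
      rw [Subgroup.mem_comap, QuotientGroup.mk'_apply, (QuotientGroup.eq_one_iff x).2 hx]
      exact H.one_mem
    exact fun x hx => this (x := ⟨x, hAB.le hx⟩) hx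
  have hCn : B ≤ Subgroup.normalizer (C : Set G) := by
    refine le_normalizer_of_subgroupOf_normal hCB ?_
    rw [hCs]
    exact hH.comap _
  have hH' : H = (C.subgroupOf B).map (QuotientGroup.mk' (A.subgroupOf B)) := by
    rw [hCs, Subgroup.map_comap_eq_self_of_surjective (QuotientGroup.mk'_surjective _)]
  by_cases hCeq : C = B
  · right
    rw [hH', hCeq, Subgroup.subgroupOf_self,
      Subgroup.map_top_of_surjective _ (QuotientGroup.mk'_surjective _)]
  · left
    have : C = A := le_antisymm (hmax ⟨lt_of_le_of_ne hCB hCeq, hCn⟩ hAC) hAC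
    rw [hH', this, QuotientGroup.map_mk'_self]

theorem reflTransGen_simpleStep [Finite G] (B : Subgroup G) :
    Relation.ReflTransGen SimpleStep ⊥ B := by
  induction B using WellFoundedLT.induction with
  | ind B ih =>
    by_cases hB : B = ⊥
    · rw [hB]
    obtain ⟨A, hAB, hA⟩ := exists_simpleStep hB
    exact (ih A hAB).tail hA

theorem exists_chain_of_reflTransGen {α : Type*} {R : α → α → Prop} {a b : α}
    (h : Relation.ReflTransGen R a b) :
    ∃ (n : ℕ) (s : ℕ → α), s 0 = a ∧ s n = b ∧ ∀ i < n, R (s i) (s (i + 1)) := by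
  induction h with
  | refl => exact ⟨0, fun _ => a, rfl, rfl, fun i hi => absurd hi (Nat.not_lt_zero i)⟩
  | @tail b c _ hbc ih =>
    obtain ⟨n, s, h0, hn, hs⟩ := ih
    refine ⟨n + 1, fun i => if i ≤ n then s i else c, by simp [h0], by simp, fun i hi => ?_⟩
    rcases Nat.lt_succ_iff_lt_or_eq.1 hi with hi | rfl
    · simpa [hi.le, Nat.succ_le_of_lt hi] using hs i hi
    · simpa [hn] using hbc

/-- A composition series serves: a `π'`-factor is a `p`-group with `p ∉ π` by solubility, and any
other factor is a `π`-group because complementing twice among the primes lands inside `π`. -/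
theorem hasSolSeries_of_isPiSoluble [Finite G] {π : Set ℕ}
    (hG : IsPiSoluble (primeCompl π) G) : HasSolSeries π (⊤ : Subgroup G) := by
  obtain ⟨n, s, h0, hn, hs⟩ := exists_chain_of_reflTransGen
    (reflTransGen_simpleStep (⊤ : Subgroup G))
  have hser : IsCompositionSeries (fun i : Fin (n + 1) => s i) :=
    ⟨by simpa using h0, by simpa using hn, fun i => hs i i.2⟩
  have hstep : ∀ i < n, SolStep π (s i) (s (i + 1)) := by
    intro i hi
    obtain ⟨hle, hN, hsimple⟩ := hs i hi
    have h1 : (IsPiGroup (primeCompl π) (s (i + 1) ⧸ (s i).subgroupOf (s (i + 1))) ∨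
        IsPiGroup (primeCompl (primeCompl π)) (s (i + 1) ⧸ (s i).subgroupOf (s (i + 1)))) ∧
        (IsPiGroup (primeCompl π) (s (i + 1) ⧸ (s i).subgroupOf (s (i + 1))) →
        ∃ p ∈ primeCompl π, p.Prime ∧ IsPGroup p (s (i + 1) ⧸ (s i).subgroupOf (s (i + 1)))) :=
      hG n _ hser ⟨i, hi⟩ hN
    refine ⟨hle, le_normalizer_of_subgroupOf_normal hle hN, ?_⟩
    obtain ⟨h1 | h1, h2⟩ := h1
    · obtain ⟨p, ⟨hp, hpπ⟩, -, hpg⟩ := h2 h1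
      refine ⟨{p}, Or.inr ⟨p, hpπ, rfl⟩, ?_⟩
      rw [← oRes_top_quotient_eq_bot_iff hle, oRes_eq_bot_iff_card, Subgroup.card_top]
      intro q hq hqd
      have := Fact.mk hp
      obtain ⟨k, hk⟩ := IsPGroup.iff_card.1 hpg
      have hk' : Nat.card (s (i + 1) ⧸ (s i).subgroupOf (s (i + 1))) = p ^ k := hk
      rw [hk'] at hqd
      exact (Nat.prime_dvd_prime_iff_eq hq hp).1 (hq.dvd_of_dvd_pow hqd)
    · refine ⟨π, Or.inl rfl, ?_⟩
      rw [← oRes_top_quotient_eq_bot_iff hle, oRes_eq_bot_iff_card, Subgroup.card_top]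
      intro q hq hqd
      by_contra hqπ
      exact (h1 q hq hqd).2 ⟨hq, hqπ⟩
  have key : ∀ i ≤ n, HasSolSeries π (s i) := by
    intro i
    induction i with
    | zero => exact fun _ => h0 ▸ Relation.ReflTransGen.refl
    | succ i ih => exact fun hi => (ih (by lia)).tail (hstep i (by lia))
  exact hn ▸ key n le_rfl

end

/-! ### Covering subgroups, and π-subgroups that supplement the π-residual. -/

/-- `P` is an `𝔑^π`-covering subgroup of `L`: it lies in `𝔑^π` and covers every `𝔑^π`-quotient of
every subgroup of `L` containing it. -/
def IsCovering {G : Type*} [Group G] (π : Set ℕ) (P L : Subgroup G) : Prop :=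
  P ≤ L ∧ cRes π P = ⊥ ∧ ∀ T, P ≤ T → T ≤ L → T ≤ P ⊔ cRes π T

section

theorem card_quotient_lt {G : Type*} [Group G] [Finite G] {M : Subgroup G} (hM : M ≠ ⊥) :
    Nat.card (G ⧸ M) < Nat.card G := by
  rw [M.card_eq_card_quotient_mul_card_subgroup]
  exact lt_mul_of_one_lt_right Nat.card_pos (M.one_lt_card_iff_ne_bot.2 hM)

theorem card_lt_of_ne_top {G : Type*} [Group G] [Finite G] {S : Subgroup G} (hS : S ≠ ⊤) :
    Nat.card S < Nat.card G := by
  refine lt_of_le_of_ne (Subgroup.card_le_card_group S) fun h => hS ?_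
  exact Subgroup.card_eq_iff_eq_top S |>.1 h

theorem le_oRes_of_disjoint {G : Type*} [Group G] [Finite G] {r π : Set ℕ} {M T : Subgroup G}
    (hM : oRes r M = ⊥) (hr : ∀ p ∈ r, p ∉ π) (hMT : M ≤ T) : M ≤ oRes π T := by
  refine le_of_pElements fun x hx p hp hxp => ?_
  by_cases hpr : p ∈ r
  · exact mem_oRes (hMT hx) hp (hr p hpr) hxp
  · rw [oRes_eq_bot_iff.1 hM x hx p hp hpr hxp]
    exact Subgroup.one_mem _

theorem map_sup_eq_top_iff {G G' : Type*} [Group G] [Group G'] {f : G →* G'}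
    (hf : Function.Surjective f) {A : Subgroup G} : A.map f = ⊤ ↔ A ⊔ f.ker = ⊤ := by
  rw [← Subgroup.comap_map_eq]
  constructor
  · intro h
    rw [h, Subgroup.comap_top]
  · intro h
    rw [← Subgroup.map_comap_eq_self_of_surjective hf (A.map f), h,
      Subgroup.map_top_of_surjective f hf]

/-- Every `π`-subgroup lies in a `π`-subgroup covering the largest `π`-quotient. -/
theorem exists_le_oRes_eq_bot_sup_eq_top {π : Set ℕ} (n : ℕ) :
    ∀ (X : Type u) [Group X] [Finite X], Nat.card X < n → HasSolSeries π (⊤ : Subgroup X) →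
      ∀ A : Subgroup X, oRes π A = ⊥ →
        ∃ H, A ≤ H ∧ oRes π H = ⊥ ∧ H ⊔ oRes π (⊤ : Subgroup X) = ⊤ := by
  induction n with
  | zero => exact fun X _ _ h => absurd h (Nat.not_lt_zero _)
  | succ n ih =>
    intro X _ _ hn hX A hA
    rcases subsingleton_or_nontrivial X with hs | hnt
    · exact ⟨A, le_rfl, hA, Subsingleton.elim _ _⟩
    obtain ⟨r, hr, M, hM, hMn, hMr, hrM⟩ := exists_normal_of_hasSolSeries_top hX
    have hsurj := QuotientGroup.mk'_surjective M
    obtain ⟨H', hAH', hH', hsup⟩ := ih (X ⧸ M) (lt_of_lt_of_le (card_quotient_lt hM) (by lia))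
      (hX.quotient_top M) (A.map (QuotientGroup.mk' M)) (by rw [← oRes_map, hA, Subgroup.map_bot])
    set H := H'.comap (QuotientGroup.mk' M) with hH
    have hHmap : H.map (QuotientGroup.mk' M) = H' := Subgroup.map_comap_eq_self_of_surjective hsurj _
    have hAH : A ≤ H := Subgroup.map_le_iff_le_comap.1 hAH'
    have hMH : M ≤ H := by
      have := (QuotientGroup.mk' M).ker_le_comap H'
      rwa [QuotientGroup.ker_mk'] at this
    have hHM : oRes π H ≤ M := by
      rw [← hHmap, oRes_map_eq_bot, QuotientGroup.ker_mk'] at hH'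
      exact hH'
    have hHs : H ⊔ oRes π (⊤ : Subgroup X) = ⊤ := by
      rw [← hHmap, ← Subgroup.map_top_of_surjective _ hsurj, ← oRes_map, ← Subgroup.map_sup,
        Subgroup.map_top_of_surjective _ hsurj, map_sup_eq_top_iff hsurj, QuotientGroup.ker_mk',
        sup_right_comm, sup_eq_left.2 hMH] at hsup
      exact hsup
    rcases hr with rfl | ⟨p, hp, rfl⟩
    · exact ⟨H, hAH, oRes_eq_bot_of_le_of_oRes hHM hMr, hHs⟩
    have hMc : IsMulCommutative M := by
      refine hrM.resolve_left ?_
      rintro rfl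
      exact hp rfl
    have hdisj : ∀ q ∈ ({p} : Set ℕ), q ∉ π := by
      rintro q rfl
      exact hp
    have hN : ∀ B : Subgroup X, B ≤ Subgroup.normalizer (M : Set X) := fun B => by
      rw [Subgroup.normalizer_eq_top]; exact le_top
    obtain ⟨C, hCH, hCM, hCM', hC⟩ := exists_complement_of_oRes hMH (hN H) hMr hHM hdisj
    -- Both `A` and `C ∩ AM` complement the abelian Hall subgroup `M` of `AM`, so some `m ∈ M`
    -- conjugates the latter to `A`; then `m` moves `C` to a subgroup above `A`.
    have hAC : A ⊔ M = C ⊓ (A ⊔ M) ⊔ M := by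
      refine le_antisymm (fun x hx => ?_) (sup_le inf_le_right le_sup_right)
      obtain ⟨c, hc, m, hm, rfl⟩ := exists_mul_of_mem_sup (hN C)
        (hCM.symm ▸ sup_le hAH hMH hx : _ ∈ C ⊔ M)
      refine Subgroup.mul_mem_sup ⟨hc, ?_⟩ hm
      have := Subgroup.mul_mem _ hx (Subgroup.inv_mem _ (Subgroup.mem_sup_right hm : m ∈ A ⊔ M))
      rwa [mul_inv_cancel_right] at this
    have hcop : ∀ B : Subgroup X, oRes π B = ⊥ → Nat.Coprime (Nat.card B) (Nat.card M) :=
      fun B hB => (coprime_card_of_oRes hMr hB hdisj).symm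
    obtain ⟨m, hm, hmA⟩ := exists_conj_eq_of_abelian hMc (hN _) (hN _)
      (hcop _ (oRes_eq_bot_of_le inf_le_left hC)) (hcop _ hA) hAC.symm
    refine ⟨MulAut.conj m • C, ?_, oRes_conj_eq_bot m hC, ?_⟩
    · rw [← hmA]
      exact Subgroup.pointwise_smul_le_pointwise_smul_iff.2 inf_le_left
    · have hMo : M ≤ oRes π (⊤ : Subgroup X) := le_oRes_of_disjoint hMr hdisj le_top
      rw [← sup_eq_right.2 hMo, ← sup_assoc, conj_sup_eq_of_mem hm, hCM, hHs]

/-- Modulo a normal subgroup `B`, every `π`-subgroup of `L` lies in a `π`-subgroup covering the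
largest `π`-quotient of `L`. -/
theorem exists_oRes_le_sup_oRes {G : Type*} [Group G] [Finite G] {π : Set ℕ}
    (hG : HasSolSeries π (⊤ : Subgroup G)) {B V L : Subgroup G} (hVL : V ≤ L)
    (hL : L ≤ Subgroup.normalizer (B : Set G)) (hV : oRes π V ≤ B) :
    ∃ H, V ≤ H ∧ H ≤ L ∧ oRes π H ≤ B ∧ L ≤ H ⊔ oRes π L := by
  have hN := subgroupOf_normal_of_le hL
  set f := QuotientGroup.mk' (B.subgroupOf L) with hf
  have hsurj : Function.Surjective f := QuotientGroup.mk'_surjective _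
  have hker : f.ker = B.subgroupOf L := QuotientGroup.ker_mk' _
  have key : ∀ S : Subgroup L, oRes π (S.map f) = ⊥ ↔ oRes π (S.map L.subtype) ≤ B := by
    intro S
    rw [oRes_map_eq_bot, hker, ← oRes_map, Subgroup.map_le_iff_le_comap]
    rfl
  obtain ⟨H', hVH', hH', hsup⟩ := exists_le_oRes_eq_bot_sup_eq_top (π := π) _
    (L ⧸ B.subgroupOf L) (Nat.lt_succ_self _) ((hG.subtype_top L).quotient_top _)
    ((V.subgroupOf L).map f) (by rwa [key, Subgroup.map_subgroupOf_eq_of_le hVL])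
  have hHmap : (H'.comap f).map f = H' := Subgroup.map_comap_eq_self_of_surjective hsurj _
  have hVH : V.subgroupOf L ≤ H'.comap f := Subgroup.map_le_iff_le_comap.1 hVH'
  have hBH : f.ker ≤ H'.comap f := f.ker_le_comap H'
  refine ⟨(H'.comap f).map L.subtype, ?_, Subgroup.map_subtype_le _, ?_, ?_⟩
  · rw [← Subgroup.map_subgroupOf_eq_of_le hVL]
    exact Subgroup.map_mono hVH
  · rw [← key, hHmap, hH']
  · rw [← hHmap, ← Subgroup.map_top_of_surjective _ hsurj, ← oRes_map, ← Subgroup.map_sup,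
        Subgroup.map_top_of_surjective _ hsurj, map_sup_eq_top_iff hsurj,
        sup_right_comm, sup_eq_left.2 hBH] at hsup
    have := congrArg (Subgroup.map L.subtype) hsup
    rw [Subgroup.map_sup, oRes_map_subtype_top, ← MonoidHom.range_eq_map,
      Subgroup.range_subtype] at this
    exact this.ge

end

/-! ### Properties of covering subgroups; the case of a group that is in 𝔑^π modulo a normal
r-subgroup. -/

section

variable {G G' : Type*} [Group G] [Group G']

theorem IsCovering.mono {π : Set ℕ} {P S L : Subgroup G} (h : IsCovering π P L) (hPS : P ≤ S)
    (hSL : S ≤ L) : IsCovering π P S :=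
  ⟨hPS, h.2.1, fun T h1 h2 => h.2.2 T h1 (h2.trans hSL)⟩

theorem IsCovering.map [Finite G] {π : Set ℕ} {P L : Subgroup G} (h : IsCovering π P L)
    {f : G →* G'} (hf : Function.Injective f) : IsCovering π (P.map f) (L.map f) := by
  refine ⟨Subgroup.map_mono h.1, by rw [← cRes_map, h.2.1, Subgroup.map_bot], fun T h1 h2 => ?_⟩
  have hT : (T.comap f).map f = T :=
    Subgroup.map_comap_eq_self (h2.trans (Subgroup.map_le_range f L))
  have h3 := h.2.2 (T.comap f) (Subgroup.map_le_iff_le_comap.1 h1)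
    ((Subgroup.comap_mono h2).trans (Subgroup.comap_map_eq_self_of_injective hf L).le)
  have h4 := Subgroup.map_mono (f := f) h3
  rwa [Subgroup.map_sup, cRes_map, hT] at h4

theorem IsCovering.conj [Finite G] {π : Set ℕ} {P L : Subgroup G} (h : IsCovering π P L) (g : G) :
    IsCovering π (MulAut.conj g • P) (MulAut.conj g • L) :=
  h.map (f := (MulAut.conj g).toMonoidHom) (MulAut.conj g).injective

theorem IsCovering.of_top [Finite G] {π : Set ℕ} {S : Subgroup G} {P : Subgroup S}
    (h : IsCovering π P ⊤) : IsCovering π (P.map S.subtype) S := by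
  have := h.map S.subtype_injective
  rwa [← MonoidHom.range_eq_map, Subgroup.range_subtype] at this

theorem IsCovering.subgroupOf [Finite G] {π : Set ℕ} {P S : Subgroup G}
    (h : IsCovering π P S) : IsCovering π (P.subgroupOf S) ⊤ := by
  have hinj := Subgroup.map_injective S.subtype_injective
  refine ⟨le_top, ?_, fun T h1 _ => ?_⟩
  · apply hinj
    rw [cRes_map_subtype _ h.1, h.2.1, Subgroup.map_bot]
  · have h2 := Subgroup.map_mono (f := S.subtype) h1
    rw [Subgroup.map_subgroupOf_eq_of_le h.1] at h2
    have h3 := h.2.2 _ h2 (Subgroup.map_subtype_le T)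
    rwa [← cRes_map, ← Subgroup.map_subgroupOf_eq_of_le h.1, ← Subgroup.map_sup,
      Subgroup.map_le_map_iff_of_injective S.subtype_injective] at h3

theorem IsCovering.quotient [Finite G] {π : Set ℕ} {P : Subgroup G} (h : IsCovering π P ⊤)
    {f : G →* G'} (hf : Function.Surjective f) : IsCovering π (P.map f) ⊤ := by
  refine ⟨le_top, by rw [← cRes_map, h.2.1, Subgroup.map_bot], fun T h1 _ => ?_⟩
  have h3 := Subgroup.map_mono (f := f)
    (h.2.2 (T.comap f) (Subgroup.map_le_iff_le_comap.1 h1) le_top)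
  rwa [Subgroup.map_sup, cRes_map, Subgroup.map_comap_eq_self_of_surjective hf] at h3

theorem IsCovering.eq_of_le {π : Set ℕ} {P L T : Subgroup G} (h : IsCovering π P L) (hPT : P ≤ T)
    (hTL : T ≤ L) (hT : cRes π T = ⊥) : T = P := by
  have := h.2.2 T hPT hTL
  rw [hT, sup_bot_eq] at this
  exact le_antisymm this hPT

/-- Covering subgroups can be recognized in `P ⊔ W` and modulo the normal subgroup `W`. -/
theorem IsCovering.of_sup [Finite G] {π : Set ℕ} {P W L : Subgroup G} (hWL : W ≤ L)
    (hL : L ≤ Subgroup.normalizer (W : Set G)) (hPL : P ≤ L)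
    (h1 : ∀ T, P ⊔ W ≤ T → T ≤ L → T ≤ P ⊔ W ⊔ cRes π T) (h2 : IsCovering π P (P ⊔ W)) :
    IsCovering π P L := by
  refine ⟨hPL, h2.2.1, fun T hPT hTL => ?_⟩
  have hTW : T ≤ P ⊔ cRes π T ⊔ W := by
    -- Covering modulo `W`, applied to `TW`, gives `T ≤ P T^𝔑 W`, as `(TW)^𝔑 ≤ T^𝔑 W`.
    have h3 := h1 (T ⊔ W) (sup_le_sup_right hPT W) (sup_le hTL hWL)
    have h4 := cRes_sup_le π (hTL.trans hL)
    refine le_sup_left.trans (h3.trans (sup_le (sup_le ?_ le_sup_right) (h4.trans ?_)))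
    · exact le_sup_left.trans le_sup_left
    · exact sup_le_sup_right le_sup_right W
  have hPR : P ⊔ cRes π T ≤ T := sup_le hPT (cRes_le π T)
  have h3 := inf_sup_of_le (hPR.trans (hTL.trans hL)) hPR hTW
  -- The modular law leaves only `T ∩ W` to treat; `P(T ∩ W)` lies in both `PW` and `T`, so `h2`
  -- applies to it.
  have h4 : T ⊓ W ≤ P ⊔ cRes π T := by
    have h5 := h2.2.2 (P ⊔ T ⊓ W) le_sup_left (sup_le_sup_left inf_le_right P)
    refine le_sup_right.trans (h5.trans (sup_le_sup_left (cRes_mono ?_) P))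
    exact sup_le hPT inf_le_left
  exact h3.trans (sup_le le_rfl h4)

theorem cRes_sup_eq_bot [Finite G] {π : Set ℕ} {A B : Subgroup G}
    (h : A ≤ Subgroup.centralizer (B : Set G)) (hAB : A ⊓ B = ⊥) (hA : cRes π A = ⊥)
    (hB : cRes π B = ⊥) : cRes π (A ⊔ B) = ⊥ := by
  have h1 := cRes_sup_le π (h.trans (Subgroup.centralizer_le_normalizer _))
  have h' : B ≤ Subgroup.centralizer (A : Set G) := by
    rwa [Subgroup.le_centralizer_iff]
  have h2 := cRes_sup_le π (h'.trans (Subgroup.centralizer_le_normalizer _))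
  rw [sup_comm B A, hB, bot_sup_eq] at h2
  rw [hA, bot_sup_eq] at h1
  exact eq_bot_iff.2 (hAB ▸ le_inf h2 h1)

/-- If the `p`-elements of `A` and the `q`-elements of `B` commute modulo `L` for all `p` and `q`,
then so do `A` and `B`. -/
theorem commutator_mem_of_pElements [Finite G] {A B L : Subgroup G}
    (hA : A ≤ Subgroup.normalizer (L : Set G)) (hB : B ≤ Subgroup.normalizer (L : Set G))
    (h : ∀ p q : ℕ, p.Prime → q.Prime → ∀ x ∈ A, ∀ y ∈ B, IsPElement p x → IsPElement q y →
      ⁅x, y⁆ ∈ L) {x y : G} (hx : x ∈ A) (hy : y ∈ B) : ⁅x, y⁆ ∈ L := by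
  set N := Subgroup.normalizer (L : Set G) with hN
  set f := QuotientGroup.mk' (L.subgroupOf N) with hf
  have hmem : ∀ a b : N, ⁅(a : G), (b : G)⁆ ∈ L ↔ Commute (f a) (f b) := by
    intro a b
    rw [← commutatorElement_eq_one_iff_commute, ← map_commutatorElement, hf,
      QuotientGroup.mk'_apply, QuotientGroup.eq_one_iff]
    rfl
  -- Modulo `L`, centralizers are subgroups, so it suffices to test prime power elements, first of
  -- `A` and then of `B`.
  have key : A.subgroupOf N ≤ (Subgroup.centralizer ((B.subgroupOf N).map f : Set _)).comap f := by
    refine le_of_pElements fun a ha p hp hap => ?_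
    have h2 : B.subgroupOf N ≤ (Subgroup.centralizer {f a}).comap f := by
      refine le_of_pElements fun b hb q hq hbq => ?_
      rw [Subgroup.mem_comap, Subgroup.mem_centralizer_singleton_iff]
      exact ((hmem a b).1 (h p q hp hq a ha b hb (hap.map N.subtype) (hbq.map N.subtype))).symm
    rw [Subgroup.mem_comap, Subgroup.mem_centralizer_iff]
    rintro _ ⟨b, hb, rfl⟩
    exact Subgroup.mem_centralizer_singleton_iff.1 (h2 hb)
  refine (hmem ⟨x, hA hx⟩ ⟨y, hB hy⟩).2 ?_
  have := key (x := ⟨x, hA hx⟩) hx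
  rw [Subgroup.mem_comap, Subgroup.mem_centralizer_iff] at this
  exact (this _ ⟨⟨y, hB hy⟩, hy, rfl⟩).symm

theorem cRes_empty_eq_bot {π : Set ℕ} {Y : Subgroup G} (h : cRes π Y = ⊥) (h' : oRes πᶜ Y = ⊥) :
    cRes ∅ Y = ⊥ := by
  rw [eq_bot_iff, cRes_le_iff]
  intro p q hp hq hpq _ x hx y hy hxp hyq
  by_cases hpπ : p ∈ π
  · rw [oRes_eq_bot_iff.1 h' x hx p hp (fun h => h hpπ) hxp, commutatorElement_one_left]
    exact Subgroup.one_mem _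
  · rw [← h]
    exact mem_cRes hp hq hpq (fun h => absurd h hpπ) hx hy hxp hyq

/-- If `r = π`, the complements are `π'`-groups in `𝔑^π`, hence nilpotent; otherwise `M` is abelian.
Either way conjugacy avoids the odd order theorem. -/
theorem exists_conj_eq_of_cRes_eq_bot [Finite G] {π r : Set ℕ} {M Y₁ Y₂ : Subgroup G}
    (hM : oRes r M = ⊥) (hr : r = π ∨ IsMulCommutative M)
    (h₁ : oRes rᶜ Y₁ = ⊥) (h₂ : oRes rᶜ Y₂ = ⊥) (hc₁ : cRes π Y₁ = ⊥) (hc₂ : cRes π Y₂ = ⊥)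
    (hn₁ : Y₁ ≤ Subgroup.normalizer (M : Set G)) (hn₂ : Y₂ ≤ Subgroup.normalizer (M : Set G))
    (h : Y₁ ⊔ M = Y₂ ⊔ M) : ∃ m ∈ M, MulAut.conj m • Y₁ = Y₂ := by
  rcases hr with rfl | hr
  · exact exists_conj_eq_of_nilpotent hM h₁ h₂ (cRes_empty_eq_bot hc₁ h₁)
      (cRes_empty_eq_bot hc₂ h₂) hn₁ hn₂ h
  · exact exists_conj_eq_of_abelian hr hn₁ hn₂
      (coprime_card_of_oRes h₁ hM fun p hp hp' => hp hp')
      (coprime_card_of_oRes h₂ hM fun p hp hp' => hp hp') h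

theorem map_mk'_cRes_top_eq_bot [Finite G] {π : Set ℕ} {M : Subgroup G} [M.Normal]
    (h : cRes π (⊤ : Subgroup G) ≤ M) : cRes π (⊤ : Subgroup (G ⧸ M)) = ⊥ := by
  rw [← Subgroup.map_top_of_surjective _ (QuotientGroup.mk'_surjective M), cRes_map_eq_bot,
    QuotientGroup.ker_mk']
  exact h

/-- If `M` is a normal `r`-subgroup with quotient in `𝔑^π`, then `M` together with the
`r`-elements generates an `r`-group. -/
theorem oRes_sup_oRes_compl_eq_bot [Finite G] {π r : Set ℕ} (hr : IsComponent π r)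
    {M : Subgroup G} [hMn : M.Normal] (hM : oRes r M = ⊥) (h : cRes π (⊤ : Subgroup G) ≤ M) :
    oRes r (M ⊔ oRes rᶜ (⊤ : Subgroup G)) = ⊥ := by
  have h1 := oRes_oRes_compl_eq_bot (commute_of_cRes hr (map_mk'_cRes_top_eq_bot h))
  have hsurj := QuotientGroup.mk'_surjective M
  rw [← Subgroup.map_top_of_surjective _ hsurj, ← oRes_map, oRes_map_eq_bot,
    QuotientGroup.ker_mk'] at h1
  have h2 := oRes_sup_le r (T := oRes rᶜ (⊤ : Subgroup G)) (N := M)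
    (by rw [Subgroup.normalizer_eq_top]; exact le_top)
  rw [sup_comm M]
  exact oRes_eq_bot_of_le_of_oRes (h2.trans (sup_le h1 le_rfl)) hM

theorem oRes_normal [Finite G] (ρ : Set ℕ) {T : Subgroup G} [T.Normal] : (oRes ρ T).Normal := by
  rw [← Subgroup.normalizer_eq_top_iff, eq_top_iff, ← Subgroup.normalizer_eq_top (H := T)]
  exact normalizer_le_normalizer_oRes ρ T

/-- The commutators of `n` with `Y` lie in `Y` and in the normal subgroup `H`. -/
theorem mem_centralizer_of_conj_smul [Finite G] {Y H : Subgroup G} [H.Normal] (hYH : Y ⊓ H = ⊥)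
    {n : G} (hn : n ∈ H) (hnY : n ∈ Subgroup.normalizer (Y : Set G)) :
    n ∈ Subgroup.centralizer (Y : Set G) := by
  rw [Subgroup.mem_centralizer_iff]
  intro y hy
  have h1 : ⁅n, y⁆ ∈ Y ⊓ H := by
    refine ⟨Y.mul_mem ((Subgroup.mem_normalizer_iff.1 hnY y).1 hy) (Y.inv_mem hy), ?_⟩
    have : ⁅n, y⁆ = n * (y * n⁻¹ * y⁻¹) := by simp [commutatorElement_def, mul_assoc]
    rw [this]
    exact H.mul_mem hn (Subgroup.Normal.conj_mem inferInstance _ (H.inv_mem hn) y)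
  rw [hYH, Subgroup.mem_bot, commutatorElement_eq_one_iff_commute] at h1
  exact h1.eq.symm

/-- With `H` the normal Hall `r`-subgroup and `Y` a complement, the subgroup is `Y × C_H(Y)`. For
`T` above it, an element `x` of `T ∩ H` commutes with `Y` modulo `T^𝔑`, so `x` agrees up to `T^𝔑`
with an element normalizing, hence centralizing, `Y`. -/
theorem exists_isCovering_of_cRes_le [Finite G] {π r : Set ℕ} (hr : IsComponent π r)
    {M : Subgroup G} [hMn : M.Normal] (hM : oRes r M = ⊥) (hrM : r = π ∨ IsMulCommutative M)
    (h : cRes π (⊤ : Subgroup G) ≤ M) : ∃ P : Subgroup G, IsCovering π P ⊤ := by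
  set H := M ⊔ oRes rᶜ (⊤ : Subgroup G) with hH
  have hHr : oRes r H = ⊥ := oRes_sup_oRes_compl_eq_bot hr hM h
  have := oRes_normal rᶜ (T := (⊤ : Subgroup G))
  have hHn : H.Normal := Subgroup.sup_normal _ _
  have hN : ∀ B : Subgroup G, B ≤ Subgroup.normalizer (H : Set G) := fun B => by
    rw [Subgroup.normalizer_eq_top]; exact le_top
  obtain ⟨Y, -, hYH, hYH', hY⟩ := exists_complement_of_oRes (s := rᶜ) le_top (hN ⊤) hHr
    le_sup_right (fun p hp hp' => hp' hp)
  have hcY : cRes π Y = ⊥ := by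
    rw [eq_bot_iff, ← hYH']
    exact le_inf (cRes_le π Y) ((cRes_mono le_top).trans (h.trans le_sup_left))
  set C := H ⊓ Subgroup.centralizer (Y : Set G) with hC
  have hYC : Y ≤ Subgroup.centralizer (C : Set G) :=
    Subgroup.le_centralizer_iff.1 inf_le_right
  refine ⟨Y ⊔ C, le_top, cRes_sup_eq_bot hYC ?_ hcY ?_, fun T hPT _ => ?_⟩
  · exact eq_bot_iff.2 ((inf_le_inf_left Y inf_le_left).trans hYH'.le)
  · exact cRes_eq_bot_of_oRes_eq_bot hr (oRes_eq_bot_of_le inf_le_left hHr)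
  have hYT : Y ≤ T := le_sup_left.trans hPT
  set L := cRes π T with hL
  have hTL : T ≤ Subgroup.normalizer (L : Set G) := le_normalizer_cRes π T
  have hLM : L ≤ M := (cRes_mono le_top).trans h
  have hLr : oRes r L = ⊥ := oRes_eq_bot_of_le hLM hM
  have hLc : r = π ∨ IsMulCommutative L := by
    refine hrM.imp_right fun hc => ?_
    rw [← Subgroup.le_centralizer_iff_isMulCommutative] at hc ⊢
    exact hLM.trans (hc.trans (Subgroup.centralizer_le hLM))
  have hTH : T ⊓ H ≤ Y ⊔ C ⊔ L := by
    rintro x ⟨hxT, hxH⟩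
    have hcomm : ∀ y ∈ Y, ⁅x, y⁆ ∈ L := fun y hy => by
      refine commutator_mem_of_pElements (A := T ⊓ H) (B := Y) (inf_le_left.trans hTL)
        (hYT.trans hTL) ?_ ⟨hxT, hxH⟩ hy
      intro p q hp hq a ha b hb hap hbq
      by_cases hpr : p ∈ r
      · by_cases hqr : q ∈ r
        · rw [oRes_eq_bot_iff.1 hY b hb q hq (fun h => h hqr) hbq, commutatorElement_one_right]
          exact Subgroup.one_mem _
        · refine mem_cRes hp hq (fun h => hqr (h ▸ hpr)) ?_ ha.1 (hYT hb) hap hbq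
          rcases hr with rfl | ⟨s, hs, rfl⟩
          · exact fun _ => hqr
          · exact fun h => absurd (Set.mem_singleton_iff.1 hpr ▸ h) hs
      · rw [oRes_eq_bot_iff.1 hHr a ha.2 p hp hpr hap, commutatorElement_one_left]
        exact Subgroup.one_mem _
    have hconj : MulAut.conj x • Y ⊔ L = Y ⊔ L := by
      have hxL : MulAut.conj x • L = L := mem_normalizer_iff_conj_smul.1 (hTL hxT)
      have h1 : MulAut.conj x • (Y ⊔ L) ≤ Y ⊔ L := by
        rw [Subgroup.smul_sup, hxL]
        refine sup_le ?_ le_sup_right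
        rintro _ ⟨y, hy, rfl⟩
        have h2 := Subgroup.mul_mem _ (Subgroup.mem_sup_right (hcomm y hy) : _ ∈ Y ⊔ L)
          (Subgroup.mem_sup_left hy)
        rwa [commutatorElement_def, inv_mul_cancel_right] at h2
      have h2 := mem_normalizer_iff_conj_smul.1 (mem_normalizer_of_conj_smul_le h1)
      rwa [Subgroup.smul_sup, hxL] at h2
    have hYx : MulAut.conj x • Y ≤ Subgroup.normalizer (L : Set G) :=
      (le_sup_left.trans hconj.le).trans (sup_le (hYT.trans hTL) Subgroup.le_normalizer)
    obtain ⟨l, hl, hlY⟩ := exists_conj_eq_of_cRes_eq_bot hLr hLc hY (oRes_conj_eq_bot x hY) hcY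
      (cRes_conj_eq_bot x hcY) (hYT.trans hTL) hYx hconj.symm
    -- `Y` and its conjugate by `x` complement `L` in the same group, so they are conjugate by some
    -- `l ∈ L`, and `l⁻¹x` normalizes `Y`.
    have hn : l⁻¹ * x ∈ C := by
      have hnH : l⁻¹ * x ∈ H := H.mul_mem (H.inv_mem (hLM.trans le_sup_left hl)) hxH
      refine ⟨hnH, mem_centralizer_of_conj_smul hYH' hnH ?_⟩
      rw [mem_normalizer_iff_conj_smul, map_mul, mul_smul, ← hlY, ← mul_smul, ← map_mul,
        inv_mul_cancel, map_one, one_smul]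
    have := Subgroup.mul_mem (Y ⊔ C ⊔ L) (Subgroup.mem_sup_right hl)
      (Subgroup.mem_sup_left (Subgroup.mem_sup_right hn))
    rwa [mul_inv_cancel_left] at this
  exact (inf_sup_of_le (hN Y) hYT (le_top.trans hYH.ge)).trans
    (sup_le (le_sup_left.trans le_sup_left) hTH)

/-- The `r'`-parts of `P` and `Q` are complements of `M` in one subgroup, so they may be assumed
equal to some `Y`. Then `⟨P, Q⟩` normalizes `Y` and is `Y` times an `r`-group centralizing it; so it
lies in `𝔑^π`, and both covering subgroups equal it. -/
theorem exists_conj_eq_of_cRes_le [Finite G] {π r : Set ℕ} (hr : IsComponent π r)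
    {M : Subgroup G} [hMn : M.Normal] (hM : oRes r M = ⊥) (hrM : r = π ∨ IsMulCommutative M)
    (h : cRes π (⊤ : Subgroup G) ≤ M) {P Q : Subgroup G} (hP : IsCovering π P ⊤)
    (hQ : IsCovering π Q ⊤) : ∃ x : G, MulAut.conj x • P = Q := by
  set H := M ⊔ oRes rᶜ (⊤ : Subgroup G) with hH
  have hHr : oRes r H = ⊥ := oRes_sup_oRes_compl_eq_bot hr hM h
  have := oRes_normal rᶜ (T := (⊤ : Subgroup G))
  have hHn : H.Normal := Subgroup.sup_normal _ _
  have hN : ∀ B : Subgroup G, B ≤ Subgroup.normalizer (M : Set G) := fun B => by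
    rw [Subgroup.normalizer_eq_top]; exact le_top
  have hNH : ∀ B : Subgroup G, B ≤ Subgroup.normalizer (H : Set G) := fun B => by
    rw [Subgroup.normalizer_eq_top]; exact le_top
  have key : ∀ R : Subgroup G, IsCovering π R ⊤ →
      oRes rᶜ (oRes r R) = ⊥ ∧ oRes r R ⊔ M = oRes r (⊤ : Subgroup G) ⊔ M := by
    intro R hR
    constructor
    · have := oRes_oRes_compl_eq_bot (compl_commute (commute_of_cRes hr hR.2.1))
      rwa [compl_compl] at this
    · refine le_antisymm (sup_le_sup_right (oRes_mono le_top) M) (sup_le ?_ le_sup_right)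
      have h1 : (⊤ : Subgroup G) = R ⊔ M :=
        top_le_iff.1 ((hR.2.2 ⊤ le_top le_rfl).trans (sup_le_sup_left h R)) |>.symm
      rw [h1]
      exact oRes_sup_le r (hN R)
  obtain ⟨hP1, hP2⟩ := key P hP
  obtain ⟨hQ1, hQ2⟩ := key Q hQ
  obtain ⟨m, -, hm⟩ := exists_conj_eq_of_cRes_eq_bot hM hrM hP1 hQ1
    (cRes_eq_bot_of_le (oRes_le _ _) hP.2.1) (cRes_eq_bot_of_le (oRes_le _ _) hQ.2.1)
    (hN _) (hN _) (hP2.trans hQ2.symm)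
  refine ⟨m, ?_⟩
  have hP' := hP.conj m
  rw [Subgroup.Normal.conj_smul_eq_self m (⊤ : Subgroup G)] at hP'
  rw [← oRes_conj] at hm
  set P' := MulAut.conj m • P with hP'def
  set Y := oRes r Q with hY
  have hYH : Y ⊓ H = ⊥ := inf_eq_bot_of_oRes hQ1 hHr fun p hp hp' => hp hp'
  have hYtop : Y ⊔ H = ⊤ := by
    rw [hH, ← sup_assoc, hQ2, sup_right_comm, oRes_sup_oRes_compl, top_sup_eq]
  have hS : P' ⊔ Q ≤ Subgroup.normalizer (Y : Set G) :=
    sup_le (hm ▸ le_normalizer_oRes r P') (le_normalizer_oRes r Q)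
  have hYS : Y ≤ P' ⊔ Q := (oRes_le _ _).trans le_sup_right
  have hSc : cRes π (P' ⊔ Q) = ⊥ := by
    set D := (P' ⊔ Q) ⊓ H with hD
    have hSD : P' ⊔ Q = Y ⊔ D :=
      le_antisymm (inf_sup_of_le (hNH Y) hYS (le_top.trans hYtop.ge)) (sup_le hYS inf_le_left)
    have hYD : D ≤ Subgroup.centralizer (Y : Set G) := fun n hn =>
      mem_centralizer_of_conj_smul hYH hn.2 (hS hn.1)
    rw [hSD]
    refine cRes_sup_eq_bot (Subgroup.le_centralizer_iff.1 hYD) ?_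
      (cRes_eq_bot_of_le (oRes_le _ _) hQ.2.1)
      (cRes_eq_bot_of_oRes_eq_bot hr (oRes_eq_bot_of_le inf_le_right hHr))
    exact eq_bot_iff.2 ((inf_le_inf_left Y inf_le_right).trans hYH.le)
  exact (hP'.eq_of_le le_sup_left le_top hSc).symm.trans (hQ.eq_of_le le_sup_right le_top hSc)

end

/-! ### Existence and conjugacy of covering subgroups. -/

section

theorem exists_isCovering_top {π : Set ℕ} (n : ℕ) :
    ∀ (X : Type u) [Group X] [Finite X], Nat.card X < n → HasSolSeries π (⊤ : Subgroup X) →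
      ∃ P : Subgroup X, IsCovering π P ⊤ := by
  induction n with
  | zero => exact fun X _ _ h => absurd h (Nat.not_lt_zero _)
  | succ n ih =>
    intro X _ _ hn hX
    rcases subsingleton_or_nontrivial X with hs | hnt
    · exact ⟨⊤, le_rfl, Subsingleton.elim _ _, fun T _ _ => le_top.trans le_sup_left⟩
    obtain ⟨r, hr, M, hM, hMn, hMr, hrM⟩ := exists_normal_of_hasSolSeries_top hX
    have hsurj := QuotientGroup.mk'_surjective M
    obtain ⟨R, hR⟩ := ih (X ⧸ M) (lt_of_lt_of_le (card_quotient_lt hM) (by lia))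
      (hX.quotient_top M)
    set S := R.comap (QuotientGroup.mk' M) with hS
    have hSmap : S.map (QuotientGroup.mk' M) = R := Subgroup.map_comap_eq_self_of_surjective hsurj _
    have hMS : M ≤ S := by
      have := (QuotientGroup.mk' M).ker_le_comap R
      rwa [QuotientGroup.ker_mk'] at this
    have hSM : cRes π S ≤ M := by
      have h1 := hR.2.1
      rw [← hSmap, cRes_map_eq_bot, QuotientGroup.ker_mk'] at h1
      exact h1
    by_cases hStop : S = ⊤
    -- If the preimage `S` of the covering subgroup `R` of `X/M` is all of `X`, then `X^𝔑 ≤ M`;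
    -- otherwise a covering subgroup of `S` works for `X`.
    · exact exists_isCovering_of_cRes_le hr hMr hrM (hStop ▸ hSM)
    obtain ⟨P, hP⟩ := ih S (lt_of_lt_of_le (card_lt_of_ne_top hStop) (by lia)) (hX.subtype_top S)
    have hP := hP.of_top
    set P' := P.map S.subtype with hP'
    have hSP : S ≤ P' ⊔ M := (hP.2.2 S hP.1 le_rfl).trans (sup_le_sup_left hSM P')
    refine ⟨P', IsCovering.of_sup le_top (by rw [Subgroup.normalizer_eq_top]) le_top ?_
      (hP.mono le_sup_left (sup_le hP.1 hMS))⟩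
    intro T hT _
    have h1 : R ≤ T.map (QuotientGroup.mk' M) := by
      rw [← hSmap]
      exact Subgroup.map_mono (hSP.trans hT)
    have h2 := hR.2.2 _ h1 le_top
    rw [← cRes_map, ← hSmap, ← Subgroup.map_sup, Subgroup.map_le_map_iff,
      QuotientGroup.ker_mk'] at h2
    refine h2.trans (sup_le (sup_le_sup_right hSP _) (le_sup_right.trans le_sup_left))

theorem exists_conj_eq_of_isCovering_top {π : Set ℕ} (n : ℕ) :
    ∀ (X : Type u) [Group X] [Finite X], Nat.card X < n → HasSolSeries π (⊤ : Subgroup X) →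
      ∀ P Q : Subgroup X, IsCovering π P ⊤ → IsCovering π Q ⊤ → ∃ x : X, MulAut.conj x • P = Q := by
  induction n with
  | zero => exact fun X _ _ h => absurd h (Nat.not_lt_zero _)
  | succ n ih =>
    intro X _ _ hn hX P Q hP hQ
    rcases subsingleton_or_nontrivial X with hs | hnt
    · exact ⟨1, Subsingleton.elim _ _⟩
    obtain ⟨r, hr, M, hM, hMn, hMr, hrM⟩ := exists_normal_of_hasSolSeries_top hX
    have hsurj := QuotientGroup.mk'_surjective M
    obtain ⟨y, hy⟩ := ih (X ⧸ M) (lt_of_lt_of_le (card_quotient_lt hM) (by lia))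
      (hX.quotient_top M) _ _ (hP.quotient hsurj) (hQ.quotient hsurj)
    obtain ⟨g, rfl⟩ := hsurj y
    have hg : (MulAut.conj g • P).map (QuotientGroup.mk' M) = Q.map (QuotientGroup.mk' M) := by
      rw [← hy]
      ext z
      constructor
      · rintro ⟨_, ⟨x, hx, rfl⟩, rfl⟩
        exact ⟨QuotientGroup.mk' M x, ⟨x, hx, rfl⟩, rfl⟩
      · rintro ⟨_, ⟨x, hx, rfl⟩, rfl⟩
        exact ⟨_, ⟨x, hx, rfl⟩, rfl⟩
    have hP' := hP.conj g
    rw [Subgroup.Normal.conj_smul_eq_self g (⊤ : Subgroup X)] at hP'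
    suffices h : ∃ x, MulAut.conj x • (MulAut.conj g • P) = Q by
      obtain ⟨x, hx⟩ := h
      exact ⟨x * g, by rw [map_mul, mul_smul, hx]⟩
    set P' := MulAut.conj g • P with hP'def
    have hS : P' ⊔ M = Q ⊔ M := by
      have := congrArg (Subgroup.comap (QuotientGroup.mk' M)) hg
      rwa [Subgroup.comap_map_eq, Subgroup.comap_map_eq, QuotientGroup.ker_mk'] at this
    by_cases hStop : P' ⊔ M = ⊤
    · refine exists_conj_eq_of_cRes_le hr hMr hrM ?_ hP' hQ
      have := cRes_sup_le π (T := P') (N := M) (by rw [Subgroup.normalizer_eq_top]; exact le_top)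
      rwa [hStop, hP'.2.1, bot_sup_eq] at this
    · obtain ⟨x, hx⟩ := ih ↥(P' ⊔ M) (lt_of_lt_of_le (card_lt_of_ne_top hStop) (by lia))
        (hX.subtype_top _) _ _ (hP'.mono le_sup_left le_top).subgroupOf
        (hQ.mono (hS ▸ le_sup_left) le_top).subgroupOf
      exact ⟨x, conj_map_subtype le_sup_left (hS ▸ le_sup_left) hx⟩

theorem exists_isCovering {G : Type*} [Group G] [Finite G] {π : Set ℕ}
    (hG : HasSolSeries π (⊤ : Subgroup G)) (L : Subgroup G) : ∃ P, IsCovering π P L := by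
  obtain ⟨P, hP⟩ := exists_isCovering_top _ L (Nat.lt_succ_self _) (hG.subtype_top L)
  exact ⟨_, hP.of_top⟩

/-- `𝔑^π`-covering subgroups of `L` are conjugate under the `𝔑^π`-residual of `L`. -/
theorem exists_conj_eq_of_isCovering {G : Type*} [Group G] [Finite G] {π : Set ℕ}
    (hG : HasSolSeries π (⊤ : Subgroup G)) {P Q L : Subgroup G} (hP : IsCovering π P L)
    (hQ : IsCovering π Q L) : ∃ x ∈ cRes π L, MulAut.conj x • P = Q := by
  obtain ⟨x, hx⟩ := exists_conj_eq_of_isCovering_top _ L (Nat.lt_succ_self _) (hG.subtype_top L)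
    _ _ hP.subgroupOf hQ.subgroupOf
  have hx := conj_map_subtype hP.1 hQ.1 hx
  obtain ⟨p, hp, l, hl, hpl⟩ := exists_mul_of_mem_sup (hP.1.trans (le_normalizer_cRes π L))
    (hP.2.2 L hP.1 le_rfl (L.inv_mem x.2))
  refine ⟨l⁻¹, Subgroup.inv_mem _ hl, ?_⟩
  -- `L = P L^𝔑`, and the factor from `P` does not move `P`, so the conjugator can be taken in
  -- `L^𝔑`.
  have hxe : (x : G) = l⁻¹ * p⁻¹ := by rw [← mul_inv_rev, hpl, inv_inv]
  rw [← hx, hxe, map_mul, mul_smul, Subgroup.conj_smul_eq_self_of_mem (P.inv_mem hp)]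

end

/-! ### Maximal 𝓕-subgroups, their normalizers and their conjugacy. -/

/-- `O^π(H)` is normal in `L` and `O^π(L)` normalizes `H`. -/
def IsONormal {G : Type*} [Group G] (π : Set ℕ) (H L : Subgroup G) : Prop :=
  H ≤ L ∧ L ≤ Subgroup.normalizer (oRes π H : Set G) ∧
    oRes π L ≤ Subgroup.normalizer (H : Set G)

/-- The closure properties of a Fitting set, with Dnormality replaced by `IsONormal`. -/
structure IsOFittingSet {G : Type*} [Group G] (π : Set ℕ) (𝓕 : Set (Subgroup G)) : Prop where
  mem_of_isONormal : ∀ S T : Subgroup G, S ∈ 𝓕 → IsONormal π T S → T ∈ 𝓕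
  sup_mem : ∀ S T : Subgroup G, S ∈ 𝓕 → T ∈ 𝓕 → IsONormal π S (S ⊔ T) →
    IsONormal π T (S ⊔ T) → S ⊔ T ∈ 𝓕
  conj_mem : ∀ (S : Subgroup G) (x : G), S ∈ 𝓕 → MulAut.conj x • S ∈ 𝓕

section

variable {G : Type*} [Group G] {π : Set ℕ} {𝓕 : Set (Subgroup G)}

theorem conj_smul_le_iff {A B : Subgroup G} {g : G} :
    MulAut.conj g • A ≤ B ↔ A ≤ B.comap (MulAut.conj g).toMonoidHom :=
  Subgroup.map_le_iff_le_comap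

theorem IsONormal.mono {H S L : Subgroup G} (h : IsONormal π H L) (hHS : H ≤ S) (hSL : S ≤ L) :
    IsONormal π H S :=
  ⟨hHS, hSL.trans h.2.1, (oRes_mono hSL).trans h.2.2⟩

theorem IsFMaximalIn.mono {L S V : Subgroup G} (h : IsFMaximalIn 𝓕 L V) (hVS : V ≤ S)
    (hSL : S ≤ L) : IsFMaximalIn 𝓕 S V :=
  ⟨⟨hVS, h.prop.2⟩, fun _ hT => h.2 ⟨hT.1.trans hSL, hT.2⟩⟩

theorem IsFMaximalIn.conj (h𝓕 : IsOFittingSet π 𝓕) {L V : Subgroup G} (h : IsFMaximalIn 𝓕 L V)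
    {g : G} (hg : g ∈ Subgroup.normalizer (L : Set G)) : IsFMaximalIn 𝓕 L (MulAut.conj g • V) := by
  rw [mem_normalizer_iff_conj_smul] at hg
  refine ⟨⟨?_, h𝓕.conj_mem V g h.prop.2⟩, fun T hT hVT => ?_⟩
  · have := Subgroup.pointwise_smul_le_pointwise_smul_iff (a := MulAut.conj g).2 h.prop.1
    rwa [hg] at this
  · rw [Subgroup.subset_pointwise_smul_iff, ← map_inv]
    refine h.2 ⟨?_, h𝓕.conj_mem T g⁻¹ hT.2⟩ ?_
    · rw [map_inv, ← Subgroup.subset_pointwise_smul_iff, hg]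
      exact hT.1
    · rw [map_inv]
      exact Subgroup.pointwise_smul_subset_iff.1 hVT

/-- The Frattini argument for conjugacy under a subgroup `K`. -/
theorem le_normalizer_inf_sup_of_conj {V K L : Subgroup G} (hKL : K ≤ L)
    (h : ∀ g ∈ L, ∃ x ∈ K, MulAut.conj x • V = MulAut.conj g • V) :
    L ≤ Subgroup.normalizer (V : Set G) ⊓ L ⊔ K := by
  intro g hg
  obtain ⟨x, hx, hxg⟩ := h g hg
  have h1 : x⁻¹ * g ∈ Subgroup.normalizer (V : Set G) ⊓ L := by
    refine ⟨?_, L.mul_mem (L.inv_mem (hKL hx)) hg⟩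
    change x⁻¹ * g ∈ Subgroup.normalizer (V : Set G)
    rw [mem_normalizer_iff_conj_smul, map_mul, mul_smul, ← hxg, ← mul_smul,
      ← map_mul, inv_mul_cancel, map_one, one_smul]
  have := Subgroup.mul_mem _ (Subgroup.mem_sup_right hx)
    (Subgroup.mem_sup_left h1 : _ ∈ Subgroup.normalizer (V : Set G) ⊓ L ⊔ K)
  rwa [mul_inv_cancel_left] at this

variable [Finite G]

theorem isONormal_of_le_normalizer {H L : Subgroup G} (hHL : H ≤ L)
    (h : L ≤ Subgroup.normalizer (H : Set G)) : IsONormal π H L :=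
  ⟨hHL, h.trans (normalizer_le_normalizer_oRes π H), (oRes_le π L).trans h⟩

theorem IsONormal.conj {H L : Subgroup G} (h : IsONormal π H L) (g : G) :
    IsONormal π (MulAut.conj g • H) (MulAut.conj g • L) := by
  refine ⟨Subgroup.pointwise_smul_le_pointwise_smul_iff.2 h.1, ?_, ?_⟩
  · rw [oRes_conj, conj_smul_le_normalizer_iff]
    exact h.2.1
  · rw [oRes_conj, conj_smul_le_normalizer_iff]
    exact h.2.2

/-- An `𝓕`-maximal subgroup that is Dnormal in a subgroup is normal in it. -/
theorem IsFMaximalIn.le_normalizer_of_isONormal (h𝓕 : IsOFittingSet π 𝓕) {L V T : Subgroup G}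
    (h : IsFMaximalIn 𝓕 L V) (hVT : IsONormal π V T) (hTL : T ≤ L) :
    T ≤ Subgroup.normalizer (V : Set G) := by
  intro t ht
  have hconj := hVT.conj t
  rw [Subgroup.conj_smul_eq_self_of_mem ht] at hconj
  have hle : V ⊔ MulAut.conj t • V ≤ T := sup_le hVT.1 hconj.1
  have := h𝓕.sup_mem V (MulAut.conj t • V) h.prop.2 (h𝓕.conj_mem V t h.prop.2)
    (hVT.mono le_sup_left hle) (hconj.mono le_sup_right hle)
  exact mem_normalizer_of_conj_smul_le
    (le_sup_right.trans (h.2 ⟨hle.trans hTL, this⟩ le_sup_left))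

theorem IsOFittingSet.mem_of_le_normalizer (h𝓕 : IsOFittingSet π 𝓕) {S T : Subgroup G}
    (hS : S ∈ 𝓕) (hTS : T ≤ S) (h : S ≤ Subgroup.normalizer (T : Set G)) : T ∈ 𝓕 :=
  h𝓕.mem_of_isONormal S T hS (isONormal_of_le_normalizer hTS h)

/-- The join of two normal `𝓕`-subgroups of `A` is in `𝓕`, so `V` absorbs `S`: it is the `𝓕`-radical
of `A`. -/
theorem IsFMaximalIn.le_of_le_normalizer (h𝓕 : IsOFittingSet π 𝓕) {L V S A : Subgroup G}
    (h : IsFMaximalIn 𝓕 L V) (hS : S ∈ 𝓕) (hAL : A ≤ L) (hSA : S ≤ A) (hVA : V ≤ A)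
    (hAS : A ≤ Subgroup.normalizer (S : Set G)) (hAV : A ≤ Subgroup.normalizer (V : Set G)) :
    S ≤ V := by
  have hle : V ⊔ S ≤ A := sup_le hVA hSA
  have := h𝓕.sup_mem V S h.prop.2 hS (isONormal_of_le_normalizer le_sup_left (hle.trans hAV))
    (isONormal_of_le_normalizer le_sup_right (hle.trans hAS))
  exact le_sup_right.trans (h.2 ⟨hle.trans hAL, this⟩ le_sup_left)

theorem IsFMaximalIn.inf_eq (h𝓕 : IsOFittingSet π 𝓕) {K W V : Subgroup G}
    (hW : IsFMaximalIn 𝓕 K W) (hV : V ∈ 𝓕) (hVK : V ≤ Subgroup.normalizer (K : Set G))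
    (hWV : W ≤ V) : V ⊓ K = W := by
  refine le_antisymm (hW.2 ⟨inf_le_right, ?_⟩ (le_inf hWV hW.prop.1)) (le_inf hWV hW.prop.1)
  exact h𝓕.mem_of_le_normalizer hV inf_le_left (le_normalizer_inf Subgroup.le_normalizer hVK)

/-- For `p ∉ π`, if the Sylow `p`-subgroup `S` were not in `Y`, the normalizer condition would give
an element of `S` outside `Y` normalizing `Y ∩ S`. It centralizes the `p'`-elements of `Y`, hence
normalizes `Y`. -/
theorem oRes_top_le_of_normalizer_le {X : Type*} [Group X] [Finite X] {π : Set ℕ}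
    (hX : cRes π (⊤ : Subgroup X) = ⊥) {Y : Subgroup X}
    (hY : Subgroup.normalizer (Y : Set X) ≤ Y) : oRes π (⊤ : Subgroup X) ≤ Y := by
  rw [oRes_le_iff]
  intro x _ p hp hpπ hxp
  have := Fact.mk hp
  set S := oRes {p}ᶜ (⊤ : Subgroup X) with hS
  have hSp : IsPGroup p S := isPGroup_of_oRes
    (oRes_oRes_compl_eq_bot (commute_of_cRes (Or.inr ⟨p, hpπ, rfl⟩) hX))
  have hmem : ∀ y : X, IsPElement p y → y ∈ S := fun y hy =>
    mem_oRes (Subgroup.mem_top y) hp (fun h => h rfl) hy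
  have hSY : S ≤ Y := by
    by_contra hne
    have hnil : Group.IsNilpotent S := hSp.isNilpotent
    obtain ⟨s, hs, hs'⟩ := SetLike.exists_of_lt (Group.normalizerCondition_of_isNilpotent
      (Y.subgroupOf S) (lt_top_iff_ne_top.2 fun h => hne (Subgroup.subgroupOf_eq_top.1 h)))
    refine hs' (hY (mem_normalizer_of_conj_smul_le ?_))
    rw [conj_smul_le_iff]
    refine le_of_pElements fun y hy q hq hyq => ?_
    by_cases hpq : p = q
    · subst hpq
      exact (Subgroup.mem_normalizer_iff.1 hs ⟨y, hmem y hyq⟩).1 hy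
    · have hsp : IsPElement p (s : X) := by
        obtain ⟨k, hk⟩ := hSp s
        exact ⟨k, by exact_mod_cast congrArg Subtype.val hk⟩
      have hc := commute_of_cRes_eq_bot hX hp hq hpq (fun h => absurd h hpπ)
        (Subgroup.mem_top (s : X)) (Subgroup.mem_top y) hsp hyq
      change (s : X) * y * (s : X)⁻¹ ∈ Y
      rwa [hc.eq, mul_inv_cancel_right]
  exact hSY (hmem x hxp)

/-- A self-normalizing subgroup containing the `𝔑^π`-residual contains the `π`-residual. -/
theorem oRes_le_of_inf_normalizer_le {Y L : Subgroup G} (hYL : Y ≤ L) (hL : cRes π L ≤ Y)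
    (hY : Subgroup.normalizer (Y : Set G) ⊓ L ≤ Y) : oRes π L ≤ Y := by
  have hN := subgroupOf_normal_of_le (le_normalizer_cRes π L)
  set f := QuotientGroup.mk' ((cRes π L).subgroupOf L) with hf
  have hsurj : Function.Surjective f := QuotientGroup.mk'_surjective _
  have hker : f.ker = (cRes π L).subgroupOf L := QuotientGroup.ker_mk' _
  have hkerY : f.ker ≤ Y.subgroupOf L := by
    rw [hker]
    exact Subgroup.subgroupOf_mono L hL
  have hcomap : ((Y.subgroupOf L).map f).comap f = Y.subgroupOf L := by
    rw [Subgroup.comap_map_eq, sup_eq_left.2 hkerY]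
  have h1 : oRes π (⊤ : Subgroup (L ⧸ (cRes π L).subgroupOf L)) ≤ (Y.subgroupOf L).map f := by
    apply oRes_top_le_of_normalizer_le
    · apply map_mk'_cRes_top_eq_bot
      rw [← Subgroup.map_le_map_iff_of_injective L.subtype_injective, cRes_map_subtype_top,
        Subgroup.map_subgroupOf_eq_of_le (cRes_le π L)]
    · intro z hz
      obtain ⟨g, rfl⟩ := hsurj z
      have h2 : g ∈ Subgroup.normalizer (((Y.subgroupOf L) : Subgroup L) : Set L) := by
        rw [← hcomap, ← Subgroup.comap_normalizer_eq_of_surjective _ hsurj]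
        exact hz
      refine Subgroup.mem_map_of_mem f (hY ⟨?_, g.2⟩)
      refine mem_normalizer_of_conj_smul_le ?_
      rw [conj_smul_le_iff]
      intro y hy
      exact (Subgroup.mem_normalizer_iff.1 h2 ⟨y, hYL hy⟩).1 hy
  rw [← Subgroup.map_top_of_surjective _ hsurj, ← oRes_map, Subgroup.map_le_iff_le_comap,
    hcomap] at h1
  have := Subgroup.map_mono (f := L.subtype) h1
  rwa [oRes_map_subtype_top, Subgroup.map_subgroupOf_eq_of_le hYL] at this

/-- `PV/V` is in `𝔑^π`, so `(PV)^𝔑` lies in `V` and in `K`, hence in `V ∩ K = W`; the covering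
property for `PV` finishes. -/
theorem IsFMaximalIn.le_sup_of_isCovering (h𝓕 : IsOFittingSet π 𝓕) {L K W V P : Subgroup G}
    (hLK : L ≤ Subgroup.normalizer (K : Set G)) (hLc : cRes π L ≤ K) (hW : IsFMaximalIn 𝓕 K W)
    (hV : IsFMaximalIn 𝓕 L V) (hWV : W ≤ V)
    (hP : IsCovering π P (Subgroup.normalizer (V : Set G) ⊓ L)) : V ≤ P ⊔ W := by
  have hPV : P ⊔ V ≤ Subgroup.normalizer (V : Set G) ⊓ L :=
    sup_le hP.1 (le_inf Subgroup.le_normalizer hV.prop.1)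
  have h1 : cRes π (P ⊔ V) ≤ V := by
    have := cRes_sup_le π (hP.1.trans inf_le_left)
    rwa [hP.2.1, bot_sup_eq] at this
  have h2 : cRes π (P ⊔ V) ≤ W := by
    rw [← hW.inf_eq h𝓕 hV.prop.2 (hV.prop.1.trans hLK) hWV]
    exact le_inf h1 ((cRes_mono (hPV.trans inf_le_right)).trans hLc)
  exact le_sup_right.trans ((hP.2.2 _ le_sup_left hPV).trans (sup_le_sup_left h2 P))

/-- `V` is determined by `PW` as its largest normal `𝓕`-subgroup, and conjugating `P` to `P'` takes
`PW` to `P'W`. The crux enters as the hypothesis `hcov`, so that this can be used inside the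
induction proving it. -/
theorem exists_conj_eq_of_isCovering_normalizer (hG : HasSolSeries π (⊤ : Subgroup G))
    (h𝓕 : IsOFittingSet π 𝓕) {L K W : Subgroup G}
    (hLK : L ≤ Subgroup.normalizer (K : Set G)) (hLc : cRes π L ≤ K) (hW : IsFMaximalIn 𝓕 K W)
    (hLW : L ≤ Subgroup.normalizer (W : Set G)) (hKL : K ≤ L)
    (hcov : ∀ V P, IsFMaximalIn 𝓕 L V → W ≤ V →
      IsCovering π P (Subgroup.normalizer (V : Set G) ⊓ L) → IsCovering π P L)
    {V V' : Subgroup G} (hV : IsFMaximalIn 𝓕 L V) (hV' : IsFMaximalIn 𝓕 L V') (hWV : W ≤ V)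
    (hWV' : W ≤ V') : ∃ x ∈ cRes π L, MulAut.conj x • V = V' := by
  obtain ⟨P, hP⟩ := exists_isCovering hG (Subgroup.normalizer (V : Set G) ⊓ L)
  obtain ⟨P', hP'⟩ := exists_isCovering hG (Subgroup.normalizer (V' : Set G) ⊓ L)
  obtain ⟨x, hx, hxP⟩ := exists_conj_eq_of_isCovering hG (hcov V P hV hWV hP)
    (hcov V' P' hV' hWV' hP')
  have hxL : x ∈ L := cRes_le π L hx
  refine ⟨x, hx, ?_⟩
  have hVP := IsFMaximalIn.le_sup_of_isCovering h𝓕 hLK hLc hW hV hWV hP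
  have hVP' := IsFMaximalIn.le_sup_of_isCovering h𝓕 hLK hLc hW hV' hWV' hP'
  have hxPW : MulAut.conj x • (P ⊔ W) = P' ⊔ W := by
    rw [Subgroup.smul_sup, hxP, mem_normalizer_iff_conj_smul.1 (hLW hxL)]
  have hPV : P ⊔ W ≤ Subgroup.normalizer (V : Set G) :=
    sup_le (hP.1.trans inf_le_left) (hWV.trans Subgroup.le_normalizer)
  have hPV' : P' ⊔ W ≤ Subgroup.normalizer (V' : Set G) :=
    sup_le (hP'.1.trans inf_le_left) (hWV'.trans Subgroup.le_normalizer)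
  have hxV := hV.conj h𝓕 (Subgroup.le_normalizer hxL)
  have hle := hV'.le_of_le_normalizer h𝓕 hxV.prop.2
    (sup_le (hP'.1.trans inf_le_right) (hW.prop.1.trans hKL))
    (hxPW ▸ Subgroup.pointwise_smul_le_pointwise_smul_iff.2 hVP) hVP'
    (hxPW ▸ conj_smul_le_normalizer_iff.2 hPV) hPV'
  exact le_antisymm hle (hxV.2 hV'.prop hle)

/-- If conjugacy of the `𝓕`-maximal subgroups above `W` holds in the proper subgroups of `L` above
`K`, then the normalizer of an `𝓕`-maximal subgroup above `W` supplements `K`. -/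
theorem IsFMaximalIn.le_normalizer_inf_sup (hG : HasSolSeries π (⊤ : Subgroup G))
    (h𝓕 : IsOFittingSet π 𝓕) {L K W V : Subgroup G} (hKL : K ≤ L)
    (hLK : L ≤ Subgroup.normalizer (K : Set G)) (hLc : cRes π L ≤ K) (hW : IsFMaximalIn 𝓕 K W)
    (hLW : L ≤ Subgroup.normalizer (W : Set G))
    (hconj : ∀ D, K ≤ D → D < L → ∀ V V', IsFMaximalIn 𝓕 D V → IsFMaximalIn 𝓕 D V' →
      W ≤ V → W ≤ V' → ∃ x ∈ cRes π D, MulAut.conj x • V = V')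
    (hV : IsFMaximalIn 𝓕 L V) (hWV : W ≤ V) :
    L ≤ Subgroup.normalizer (V : Set G) ⊓ L ⊔ K := by
  set Y := Subgroup.normalizer (V : Set G) ⊓ L ⊔ K with hYdef
  by_contra hLY
  have hYL : Y ≤ L := sup_le inf_le_right hKL
  have hlt : Y < L := lt_of_le_not_ge hYL hLY
  have hKY : K ≤ Y := le_sup_right
  have hVY : V ≤ Y := (le_inf Subgroup.le_normalizer hV.prop.1).trans le_sup_left
  have hWg : ∀ g ∈ L, MulAut.conj g • W = W := fun g hg => mem_normalizer_iff_conj_smul.1 (hLW hg)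
  have hWgV : ∀ g ∈ L, ∀ A : Subgroup G, W ≤ A → W ≤ MulAut.conj g • A := fun g hg A hA => by
    have := Subgroup.pointwise_smul_le_pointwise_smul_iff (a := MulAut.conj g).2 hA
    rwa [hWg g hg] at this
  -- Frattini: `V` and its conjugates under `N_L(Y)` are `𝓕`-maximal in the proper subgroup `Y`,
  -- hence conjugate under `K`.
  have hself : Subgroup.normalizer (Y : Set G) ⊓ L ≤ Y := by
    have h1 : Subgroup.normalizer (Y : Set G) ⊓ L ≤ Subgroup.normalizer (V : Set G) ⊓
        (Subgroup.normalizer (Y : Set G) ⊓ L) ⊔ K := by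
      refine le_normalizer_inf_sup_of_conj (le_inf (hKY.trans Subgroup.le_normalizer) hKL) ?_
      rintro g ⟨hgY, hgL⟩
      have hVY' := hV.mono hVY hYL
      obtain ⟨x, hx, hxV⟩ := hconj Y hKY hlt V _ hVY' (hVY'.conj h𝓕 hgY) hWV (hWgV g hgL V hWV)
      exact ⟨x, ((cRes_mono hYL).trans hLc) hx, hxV⟩
    exact h1.trans (sup_le_sup_right (inf_le_inf_left _ inf_le_right) K)
  have hoY : oRes π L ≤ Y := oRes_le_of_inf_normalizer_le hYL (hLc.trans hKY) hself
  set D := K ⊔ oRes π V with hD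
  have hoV : oRes π V ≤ V := oRes_le π V
  have hDY : D ≤ Y := sup_le hKY (hoV.trans hVY)
  have hDL : D < L := lt_of_le_of_lt hDY hlt
  have hYD : Y ≤ Subgroup.normalizer (D : Set G) := by
    refine sup_le ?_ (le_sup_left.trans Subgroup.le_normalizer)
    exact le_normalizer_sup (inf_le_right.trans hLK)
      (inf_le_left.trans (normalizer_le_normalizer_oRes π V))
  -- Test prime power elements: a `π`-element commutes with the `π'`-elements of `V` modulo `K`, and
  -- a `π'`-element lies in `O^π(L) ≤ Y`.
  have hLD : L ≤ Subgroup.normalizer (D : Set G) := by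
    refine le_of_pElements fun x hx q hq hxq => ?_
    by_cases hqπ : q ∈ π
    · refine mem_normalizer_of_conj_smul_le ?_
      rw [hD, Subgroup.smul_sup, mem_normalizer_iff_conj_smul.1 (hLK hx)]
      refine sup_le le_sup_left ?_
      rw [conj_smul_le_iff, oRes_le_iff]
      intro v hv p hp hpπ hvp
      have h1 : ⁅x, v⁆ ∈ K := hLc (mem_cRes hq hp (fun h => hpπ (h ▸ hqπ)) (fun _ => hpπ) hx
        (hV.prop.1 hv) hxq hvp)
      have h2 := Subgroup.mul_mem _ (Subgroup.mem_sup_left h1 : _ ∈ K ⊔ oRes π V)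
        (Subgroup.mem_sup_right (mem_oRes hv hp hpπ hvp))
      rwa [commutatorElement_def, inv_mul_cancel_right] at h2
    · exact hYD (hoY (mem_oRes hx hq hqπ hxq))
  set B := W ⊔ oRes π V with hB
  have hBV : B ≤ V := sup_le hWV hoV
  have hVB : V ≤ Subgroup.normalizer (B : Set G) :=
    le_normalizer_sup (hV.prop.1.trans hLW) (le_normalizer_oRes π V)
  -- An `𝓕`-subgroup `S` of `D` above `B` meets `K` in `W`, so the modular law in `D = K O^π(V)`
  -- gives `S = B`.
  have hBmax : IsFMaximalIn 𝓕 D B := by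
    refine ⟨⟨sup_le_sup_right hW.prop.1 _, h𝓕.mem_of_le_normalizer hV.prop.2 hBV hVB⟩, ?_⟩
    rintro S ⟨hSD, hS⟩ hBS
    have h1 : S ⊓ K = W :=
      hW.inf_eq h𝓕 hS ((hSD.trans hDL.le).trans hLK) (le_sup_left.trans hBS)
    have h2 := inf_sup_of_le ((hoV.trans hV.prop.1).trans hLK) (le_sup_right.trans hBS)
      (hSD.trans (sup_comm _ _).le)
    rwa [h1, sup_comm] at h2
  have hLB : L ≤ Subgroup.normalizer (B : Set G) ⊓ L ⊔ K := by
    refine le_normalizer_inf_sup_of_conj hKL fun g hg => ?_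
    obtain ⟨x, hx, hxB⟩ := hconj D le_sup_left hDL B _ hBmax (hBmax.conj h𝓕 (hLD hg)) le_sup_left
      (hWgV g hg B le_sup_left)
    exact ⟨x, ((cRes_mono hDL.le).trans hLc) hx, hxB⟩
  obtain ⟨H, hVH, hHL, hHB, hLH⟩ := exists_oRes_le_sup_oRes hG (le_inf hVB hV.prop.1)
    inf_le_left (le_sup_right : oRes π V ≤ B)
  have hHo : oRes π H = oRes π V :=
    le_antisymm (oRes_le_oRes (hHB.trans hBV)) (oRes_mono hVH)
  -- `O^π(H) = O^π(V)` is normal in `H` and lies in `V`, so `V` is `IsONormal` in `H`.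
  have hHV : H ≤ Subgroup.normalizer (V : Set G) :=
    hV.le_normalizer_of_isONormal h𝓕 ⟨hVH, hHo ▸ le_normalizer_oRes π H,
      (hHB.trans hBV).trans Subgroup.le_normalizer⟩ (hHL.trans inf_le_right)
  refine hLY (hLB.trans (sup_le (hLH.trans (sup_le ?_ ?_)) hKY))
  · exact (le_inf hHV (hHL.trans inf_le_right)).trans le_sup_left
  · exact (oRes_mono inf_le_right).trans hoY

/-- Covering subgroups of the normalizer of an `𝓕`-maximal subgroup of `L` above `W` are covering
subgroups of `L`. -/
theorem isCovering_of_isCovering_normalizer (hG : HasSolSeries π (⊤ : Subgroup G))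
    (h𝓕 : IsOFittingSet π 𝓕) {L K W V P : Subgroup G} (hKL : K ≤ L)
    (hLK : L ≤ Subgroup.normalizer (K : Set G)) (hLc : cRes π L ≤ K) (hW : IsFMaximalIn 𝓕 K W)
    (hLW : L ≤ Subgroup.normalizer (W : Set G)) (hV : IsFMaximalIn 𝓕 L V) (hWV : W ≤ V)
    (hP : IsCovering π P (Subgroup.normalizer (V : Set G) ⊓ L)) : IsCovering π P L := by
  induction L using WellFoundedLT.induction generalizing K V P with
  | ind L ih =>
    have hVP := IsFMaximalIn.le_sup_of_isCovering h𝓕 hLK hLc hW hV hWV hP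
    have hPL : P ≤ L := hP.1.trans inf_le_right
    have hWL : W ≤ L := hW.prop.1.trans hKL
    have hPW : P ⊔ W ≤ Subgroup.normalizer (V : Set G) ⊓ L :=
      sup_le hP.1 (le_inf (hWV.trans Subgroup.le_normalizer) hWL)
    refine IsCovering.of_sup hWL hLW hPL (fun T hT hTL => ?_) (hP.mono le_sup_left hPW)
    rcases hTL.lt_or_eq with hlt | rfl
    · have hcov := ih T hlt (K := K ⊓ T) (V := V) (P := P) inf_le_right
        (le_normalizer_inf (hTL.trans hLK) Subgroup.le_normalizer)
        (le_inf ((cRes_mono hTL).trans hLc) (cRes_le π T))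
        (hW.mono (le_inf hW.prop.1 (le_sup_right.trans hT)) inf_le_left) (hTL.trans hLW)
        (hV.mono (hVP.trans hT) hTL) hWV
        (hP.mono (le_inf (hP.1.trans inf_le_left) (le_sup_left.trans hT))
          (inf_le_inf_left _ hTL))
      exact (hcov.2.2 T hcov.1 le_rfl).trans (sup_le_sup_right le_sup_left _)
    -- For `T = L`, the smaller `K' = W L^𝔑` is needed: `L = N_L(V)K'` and `N_L(V) = P N_L(V)^𝔑`
    -- give exactly `L = PW L^𝔑`.
    · set K' := W ⊔ cRes π T with hK'
      have hK'K : K' ≤ K := sup_le hW.prop.1 hLc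
      have hTK' : T ≤ Subgroup.normalizer (K' : Set G) :=
        le_normalizer_sup hLW (le_normalizer_cRes π T)
      have hW' : IsFMaximalIn 𝓕 K' W := hW.mono le_sup_left hK'K
      have key := IsFMaximalIn.le_normalizer_inf_sup hG h𝓕 (hK'K.trans hKL) hTK' le_sup_right hW' hLW
        (fun D hKD hDT V₁ V₂ hV₁ hV₂ hWV₁ hWV₂ => by
          have hDK := hDT.le.trans hTK'
          have hDc : cRes π D ≤ K' := (cRes_mono hDT.le).trans le_sup_right
          have hDW := hDT.le.trans hLW
          exact exists_conj_eq_of_isCovering_normalizer hG h𝓕 hDK hDc hW' hDW hKD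
            (fun A Q hA hWA hQ => ih D hDT hKD hDK hDc hW' hDW hA hWA hQ) hV₁ hV₂ hWV₁ hWV₂)
        hV hWV
      refine key.trans (sup_le ((hP.2.2 _ hP.1 le_rfl).trans ?_) ?_)
      · exact sup_le (le_sup_left.trans le_sup_left) ((cRes_mono inf_le_right).trans le_sup_right)
      · exact sup_le_sup_right le_sup_right _

/-- The `𝓕`-maximal subgroups of `L` above `W` are conjugate under the `𝔑^π`-residual of `L`. -/
theorem IsFMaximalIn.exists_conj_eq (hG : HasSolSeries π (⊤ : Subgroup G))
    (h𝓕 : IsOFittingSet π 𝓕) {L K W V V' : Subgroup G} (hKL : K ≤ L)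
    (hLK : L ≤ Subgroup.normalizer (K : Set G)) (hLc : cRes π L ≤ K) (hW : IsFMaximalIn 𝓕 K W)
    (hLW : L ≤ Subgroup.normalizer (W : Set G)) (hV : IsFMaximalIn 𝓕 L V)
    (hV' : IsFMaximalIn 𝓕 L V') (hWV : W ≤ V) (hWV' : W ≤ V') :
    ∃ x ∈ cRes π L, MulAut.conj x • V = V' :=
  exists_conj_eq_of_isCovering_normalizer hG h𝓕 hLK hLc hW hLW hKL
    (fun _ _ hA hWA hQ => isCovering_of_isCovering_normalizer hG h𝓕 hKL hLK hLc hW hLW hA hWA hQ)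
    hV hV' hWV hWV'

end

/-! ### Translation from the definitions in the statement. -/

section

variable {G : Type*} [Group G]

theorem oRes_primeCompl {π : Set ℕ} (T : Subgroup G) : oRes (primeCompl π) T = oRes πᶜ T :=
  le_antisymm
    (oRes_le_iff.2 fun _ hx _ hp hpπ hxp => mem_oRes hx hp (fun h => hpπ ⟨hp, h⟩) hxp)
    (oRes_anti (fun _ h => h.2) T)

theorem mem_normalizer_subgroupOf {L A : Subgroup G} {x : L}
    (h : (x : G) ∈ Subgroup.normalizer (A : Set G)) :
    x ∈ Subgroup.normalizer ((A.subgroupOf L : Subgroup L) : Set L) :=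
  Subgroup.mem_normalizer_iff.2 fun y => Subgroup.mem_normalizer_iff.1 h (y : G)

theorem IsNPiFittingSet.isOFittingSet {π ρ : Set ℕ} {𝓕 : Set (Subgroup G)}
    (h𝓕 : IsNPiFittingSet π 𝓕)
    (h : ∀ H L : Subgroup G, IsONormal ρ H L → IsDnormalIn π H L) : IsOFittingSet ρ 𝓕 where
  mem_of_isONormal S T hS hT := h𝓕.fs1 S T hS (Relation.ReflTransGen.single (h T S hT))
  sup_mem S T hS hT h1 h2 := h𝓕.fs2 S T hS hT (h _ _ h1) (h _ _ h2)
  conj_mem S x hS := by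
    have := h𝓕.fs3 S x⁻¹ hS
    rw [conjSubgroup, inv_inv] at this
    exact this

theorem HasSolSeries.of_isComponent {π ρ : Set ℕ} {T : Subgroup G} (h : HasSolSeries π T)
    (hr : ∀ r, IsComponent π r → IsComponent ρ r) : HasSolSeries ρ T :=
  Relation.ReflTransGen.mono (fun _ _ ⟨h1, h2, r, hr1, hr2⟩ => ⟨h1, h2, r, hr r hr1, hr2⟩) _ _ h

variable [Finite G]

theorem isPiGroup_iff_oRes {ρ : Set ℕ} {H : Subgroup G} : IsPiGroup ρ H ↔ oRes ρ H = ⊥ :=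
  oRes_eq_bot_iff_card.symm

theorem isPiGroup_iff_oRes_top {ρ : Set ℕ} : IsPiGroup ρ G ↔ oRes ρ (⊤ : Subgroup G) = ⊥ := by
  rw [oRes_eq_bot_iff_card, Subgroup.card_top]
  rfl

theorem piResidual_eq (π : Set ℕ) : piResidual π G = oRes π (⊤ : Subgroup G) := by
  have hn : (oRes π (⊤ : Subgroup G)).Normal := oRes_normal π
  have key : ∀ N : Subgroup G, ∀ _ : N.Normal,
      IsPiGroup π (G ⧸ N) ↔ oRes π (⊤ : Subgroup G) ≤ N := by
    intro N _
    rw [isPiGroup_iff_oRes_top,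
      ← Subgroup.map_top_of_surjective _ (QuotientGroup.mk'_surjective N), oRes_map_eq_bot,
      QuotientGroup.ker_mk']
  refine le_antisymm (sInf_le ⟨hn, (key _ hn).2 le_rfl⟩) (le_sInf ?_)
  rintro N ⟨hN, hN'⟩
  exact (key N hN).1 hN'

theorem piResidualOf_eq (π : Set ℕ) (H : Subgroup G) : piResidualOf π H = oRes π H := by
  rw [piResidualOf, piResidual_eq, oRes_map_subtype_top]

theorem Group.IsNilpotent.commute_of_isPElement [Group.IsNilpotent G] {p q : ℕ} (hp : p.Prime)
    (hq : q.Prime) (hpq : p ≠ q) {x y : G} (hx : IsPElement p x) (hy : IsPElement q y) :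
    Commute x y := by
  have := Fact.mk hp
  have := Fact.mk hq
  have hnor := ((Group.isNilpotent_of_finite_tfae (G := G)).out 0 3).1 ‹_›
  have hz : ∀ {r : ℕ} [Fact r.Prime] {z : G}, IsPElement r z → ∃ P : Sylow r G, z ∈ P := by
    intro r _ z ⟨k, hk⟩
    have h1 : IsPGroup r (Subgroup.zpowers z) := by
      rintro ⟨w, n, rfl⟩
      refine ⟨k, Subtype.ext ?_⟩
      change (z ^ n) ^ r ^ k = 1
      rw [← zpow_natCast, ← zpow_mul, mul_comm, zpow_mul, zpow_natCast, hk, one_zpow]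
    obtain ⟨P, hP⟩ := h1.exists_le_sylow
    exact ⟨P, hP (Subgroup.mem_zpowers z)⟩
  obtain ⟨P, hP⟩ := hz hx
  obtain ⟨Q, hQ⟩ := hz hy
  exact Subgroup.commute_of_normal_of_disjoint (P : Subgroup G) (Q : Subgroup G) (hnor p ‹_› P)
    (hnor q ‹_› Q) (IsPGroup.disjoint_of_ne p q hpq _ _ P.isPGroup' Q.isPGroup') x y hP hQ

theorem isNilpotent_of_cRes_empty (h : cRes ∅ (⊤ : Subgroup G) = ⊥) : Group.IsNilpotent G := by
  refine ((Group.isNilpotent_of_finite_tfae (G := G)).out 0 3).2 fun p hp P => ?_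
  have hS := isPGroup_of_oRes (oRes_oRes_compl_eq_bot
    (commute_of_cRes (Or.inr ⟨p, Set.notMem_empty p, rfl⟩) h))
  have hle : (P : Subgroup G) ≤ oRes {p}ᶜ (⊤ : Subgroup G) := fun x hx => by
    obtain ⟨k, hk⟩ := P.isPGroup' ⟨x, hx⟩
    exact mem_oRes (Subgroup.mem_top x) hp.out (fun h => h rfl)
      ⟨k, congrArg Subtype.val hk⟩
  rw [← P.is_maximal' hS hle]
  exact oRes_normal _

/-- In a direct product the factors contain all `π`- and all `π'`-elements respectively. Conversely
`oRes πᶜ ⊤` and `oRes π ⊤` are the two factors. -/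
theorem isNPiGroup_iff {π : Set ℕ} : IsNPiGroup π G ↔ cRes π (⊤ : Subgroup G) = ⊥ := by
  constructor
  · rintro ⟨H, K, hHn, hKn, hHK, hH, hK, hnil⟩
    rw [isPiGroup_iff_oRes] at hH hK
    rw [oRes_primeCompl] at hK
    have hN : ∀ A B : Subgroup G, B.Normal → A ≤ Subgroup.normalizer (B : Set G) :=
      fun A B hB => by rw [Subgroup.normalizer_eq_top]; exact le_top
    have h1 : oRes π (⊤ : Subgroup G) ≤ K := by
      have := oRes_sup_le π (hN H K hKn)
      rwa [hHK.sup_eq_top, hH, bot_sup_eq] at this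
    have h2 : oRes πᶜ (⊤ : Subgroup G) ≤ H := by
      have := oRes_sup_le πᶜ (hN K H hHn)
      rwa [sup_comm, hHK.sup_eq_top, hK, bot_sup_eq] at this
    have hcomm : ∀ x ∈ H, ∀ y ∈ K, Commute x y :=
      fun x hx y hy => Subgroup.commute_of_normal_of_disjoint H K hHn hKn hHK.disjoint x y hx hy
    rw [eq_bot_iff, cRes_le_iff]
    intro p q hp hq hpq hpπ x hx y hy hxp hyq
    rw [Subgroup.mem_bot, commutatorElement_eq_one_iff_commute]
    by_cases hp' : p ∈ π
    · exact hcomm x (h2 (mem_oRes hx hp (fun h => h hp') hxp)) y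
        (h1 (mem_oRes hy hq (hpπ hp') hyq))
    · have hxK := h1 (mem_oRes hx hp hp' hxp)
      by_cases hq' : q ∈ π
      · exact (hcomm y (h2 (mem_oRes hy hq (fun h => h hq') hyq)) x hxK).symm
      · have hyK := h1 (mem_oRes hy hq hq' hyq)
        have := Group.IsNilpotent.commute_of_isPElement (G := K) hp hq hpq
          (x := ⟨x, hxK⟩) (y := ⟨y, hyK⟩)
          (IsPElement.of_map K.subtype_injective hxp) (IsPElement.of_map K.subtype_injective hyq)
        exact this.map K.subtype
  · intro h
    have hcomm := commute_of_cRes (Or.inl rfl) h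
    have hH := oRes_oRes_compl_eq_bot hcomm
    have hK := oRes_oRes_compl_eq_bot (compl_commute hcomm)
    rw [compl_compl] at hK
    refine ⟨oRes πᶜ ⊤, oRes π ⊤, oRes_normal _, oRes_normal _, ⟨?_, ?_⟩,
      isPiGroup_iff_oRes.2 hH, isPiGroup_iff_oRes.2 ?_, isNilpotent_of_cRes_empty ?_⟩
    · rw [disjoint_iff]
      exact inf_eq_bot_of_oRes hH hK fun p hp hp' => hp' hp
    · rw [codisjoint_iff, sup_comm, oRes_sup_oRes_compl]
    · rw [oRes_primeCompl]
      exact hK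
    · refine cRes_empty_eq_bot (π := π) ?_ ?_
      · apply Subgroup.map_injective (oRes π (⊤ : Subgroup G)).subtype_injective
        rw [cRes_map_subtype_top, Subgroup.map_bot]
        exact cRes_eq_bot_of_le le_top h
      · apply Subgroup.map_injective (oRes π (⊤ : Subgroup G)).subtype_injective
        rw [oRes_map_subtype_top, Subgroup.map_bot]
        exact hK

theorem isNPiGroup_subgroup_iff {π : Set ℕ} {H : Subgroup G} :
    IsNPiGroup π H ↔ cRes π H = ⊥ := by
  rw [isNPiGroup_iff, ← cRes_map_subtype_top π H,
    Subgroup.map_eq_bot_iff_of_injective _ H.subtype_injective]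

theorem cRes_top_le_nPiResidual (π : Set ℕ) : cRes π (⊤ : Subgroup G) ≤ nPiResidual π G := by
  refine le_sInf ?_
  rintro N ⟨hN, hN'⟩
  rw [isNPiGroup_iff, ← Subgroup.map_top_of_surjective _ (QuotientGroup.mk'_surjective N),
    cRes_map_eq_bot, QuotientGroup.ker_mk'] at hN'
  exact hN'

theorem cRes_le_nPiResidualOf (π : Set ℕ) (L : Subgroup G) : cRes π L ≤ nPiResidualOf π L := by
  rw [← cRes_map_subtype_top]
  exact Subgroup.map_mono (cRes_top_le_nPiResidual π)

theorem IsCovering.isNPiProjector {π : Set ℕ} {P : Subgroup G} (h : IsCovering π P ⊤) :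
    IsNPiProjector π P := by
  intro N _
  have hN := h.quotient (QuotientGroup.mk'_surjective N)
  refine ⟨isNPiGroup_subgroup_iff.2 hN.2.1, fun U hU hPU => ?_⟩
  exact (hN.eq_of_le hPU le_top (isNPiGroup_subgroup_iff.1 hU)).le

/-- For `p ∉ π` a Sylow `p`-subgroup lies in `O^π(L)`, which normalizes `H`; for `p ∈ π` all of `L`
normalizes `O^π(H)`. Only a singleton `π` demands more. -/
theorem isDnormalIn_of_isONormal {π : Set ℕ} {H L : Subgroup G} (h : IsONormal π H L)
    (hπ : ∀ p, π = {p} → L ≤ Subgroup.normalizer (H : Set G)) : IsDnormalIn π H L := by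
  have hsub : oRes π (H.subgroupOf L) = (oRes π H).subgroupOf L := by
    apply Subgroup.map_injective L.subtype_injective
    rw [oRes_map_subtype π h.1, Subgroup.map_subgroupOf_eq_of_le ((oRes_le π H).trans h.1)]
  refine ⟨h.1, fun p hp P _ x hx => mem_normalizer_subgroupOf (h.2.2 ?_),
    fun p _ P _ => ⟨fun hπp x _ => mem_normalizer_subgroupOf (hπ p hπp x.2), fun _ x _ => ?_⟩⟩
  · obtain ⟨k, hk⟩ := P.isPGroup' ⟨x, hx⟩
    refine mem_oRes x.2 hp.1 hp.2 ⟨k, ?_⟩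
    exact congrArg (fun z : P => ((z : L) : G)) hk
  · rw [piResidualOf_eq, hsub]
    exact mem_normalizer_subgroupOf (h.2.1 x.2)

/-- If `π` is a singleton, it may be replaced by the empty set: `𝔑^π` is then the class of
nilpotent groups and Dnormality is normality. -/
theorem exists_isOFittingSet {π : Set ℕ} {𝓕 : Set (Subgroup G)} (h𝓕 : IsNPiFittingSet π 𝓕)
    (hG : HasSolSeries π (⊤ : Subgroup G)) : ∃ ρ : Set ℕ, IsOFittingSet ρ 𝓕 ∧
      HasSolSeries ρ (⊤ : Subgroup G) ∧ ∀ T : Subgroup G, cRes ρ T = cRes π T := by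
  by_cases hπ : ∃ p, π = {p}
  · obtain ⟨p, rfl⟩ := hπ
    refine ⟨∅, h𝓕.isOFittingSet fun H L h => ?_, hG.of_isComponent ?_, fun T => ?_⟩
    · have hLH : L ≤ Subgroup.normalizer (H : Set G) := (le_oRes_empty L).trans h.2.2
      exact isDnormalIn_of_isONormal (isONormal_of_le_normalizer h.1 hLH) fun _ _ => hLH
    · rintro r (rfl | ⟨q, -, rfl⟩)
      · exact Or.inr ⟨p, Set.notMem_empty p, rfl⟩
      · exact Or.inr ⟨q, Set.notMem_empty q, rfl⟩
    · apply le_antisymm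
      · refine cRes_le_iff.2 fun q r hq hr hqr _ x hx y hy hxq hyr =>
          mem_cRes hq hr hqr ?_ hx hy hxq hyr
        rintro rfl hr'
        exact hqr hr'.symm
      · exact cRes_le_iff.2 fun q r hq hr hqr _ x hx y hy hxq hyr =>
          mem_cRes hq hr hqr (fun h => absurd h (Set.notMem_empty q)) hx hy hxq hyr
  · exact ⟨π, h𝓕.isOFittingSet fun H L h => isDnormalIn_of_isONormal h
      fun p hp => absurd ⟨p, hp⟩ hπ, hG, fun _ => rfl⟩

end

/-! ### The two assertions of the lemma. -/

theorem lemma2 {G : Type*} [Group G] [Finite G] (π : Set ℕ) (hπ : ∀ p ∈ π, p.Prime)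
    (hG : IsPiSoluble (primeCompl π) G)
    (𝓕 : Set (Subgroup G)) (h𝓕 : IsNPiFittingSet π 𝓕)
    (K : Subgroup G) (hK : K.Normal) (hres : nPiResidual π G ≤ K)
    (W : Subgroup G) (hW : IsFMaximalIn 𝓕 K W)
    (V V₁ : Subgroup G) (hV : IsFMaximalIn 𝓕 ⊤ V) (hV₁ : IsFMaximalIn 𝓕 ⊤ V₁)
    (hWV : W ≤ V) (hWV₁ : W ≤ V₁) :
    ((W.subgroupOf K).Normal →
      ∃ P : Subgroup G, IsNPiProjector π P ∧
        ∃ H : Subgroup G, (H : Set G) = (W : Set G) * (P : Set G) ∧ V = fRadical 𝓕 H) ∧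
    (∃ x ∈ nPiResidualOf π (V ⊔ V₁), conjSubgroup V₁ x = V) := by
  obtain ⟨ρ, hF, hS, hρ⟩ := exists_isOFittingSet h𝓕 (hasSolSeries_of_isPiSoluble hG)
  have hNK : ∀ A : Subgroup G, A ≤ Subgroup.normalizer (K : Set G) := fun A => by
    rw [Subgroup.normalizer_eq_top]; exact le_top
  have hcK : cRes ρ (⊤ : Subgroup G) ≤ K := by
    rw [hρ]
    exact (cRes_top_le_nPiResidual π).trans hres
  constructor
  · intro hWK
    have hKW := le_normalizer_of_subgroupOf_normal hW.prop.1 hWK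
    -- Each conjugate of `W` is an `𝓕`-subgroup normal in `K`, so the `𝓕`-maximal `W` absorbs it.
    have hWn : W.Normal := by
      rw [← Subgroup.normalizer_eq_top_iff, eq_top_iff]
      intro g _
      have hg : MulAut.conj g • K = K := Subgroup.Normal.conj_smul_eq_self g K
      refine mem_normalizer_of_conj_smul_le (hW.le_of_le_normalizer hF (hF.conj_mem W g hW.prop.2)
        le_rfl ?_ hW.prop.1 ?_ hKW)
      · exact (hW.conj hF (hNK ⊤ (Subgroup.mem_top g))).prop.1
      · have := conj_smul_le_normalizer_iff (g := g).2 hKW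
        rwa [hg] at this
    have hNW : (⊤ : Subgroup G) ≤ Subgroup.normalizer (W : Set G) := by
      rw [Subgroup.normalizer_eq_top]
    obtain ⟨P, hP⟩ := exists_isCovering hS (Subgroup.normalizer (V : Set G) ⊓ ⊤)
    have hcov := isCovering_of_isCovering_normalizer hS hF le_top (hNK ⊤) hcK hW hNW hV hWV hP
    have hVP := IsFMaximalIn.le_sup_of_isCovering hF (hNK ⊤) hcK hW hV hWV hP
    rw [sup_comm] at hVP
    have hPV : W ⊔ P ≤ Subgroup.normalizer (V : Set G) :=
      sup_le (hWV.trans Subgroup.le_normalizer) (hP.1.trans inf_le_left)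
    have hcov' : IsCovering π P ⊤ :=
      ⟨hcov.1, hρ P ▸ hcov.2.1, fun T h1 h2 => hρ T ▸ hcov.2.2 T h1 h2⟩
    refine ⟨P, hcov'.isNPiProjector, W ⊔ P, Subgroup.normal_mul W P, le_antisymm ?_ ?_⟩
    · exact le_sSup ⟨hVP, subgroupOf_normal_of_le hPV, hV.prop.2⟩
    · refine sSup_le ?_
      rintro S ⟨hSH, hSn, hS'⟩
      exact hV.le_of_le_normalizer hF hS' le_top hSH hVP
        (le_normalizer_of_subgroupOf_normal hSH hSn) hPV
  -- `W = A ∩ K` is normal in `A`; hence `V` and `V₁` both normalize `W`, even if `K` does not.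
  · have hWn : ∀ A : Subgroup G, A ∈ 𝓕 → W ≤ A → A ≤ Subgroup.normalizer (W : Set G) := by
      intro A hA hWA
      rw [← hW.inf_eq hF hA (hNK A) hWA]
      exact le_normalizer_inf Subgroup.le_normalizer (hNK A)
    obtain ⟨x, hx, hxV⟩ := IsFMaximalIn.exists_conj_eq hS hF (L := V ⊔ V₁) (K := K ⊓ (V ⊔ V₁))
      inf_le_right (le_normalizer_inf (hNK _) Subgroup.le_normalizer)
      (le_inf ((cRes_mono le_top).trans hcK) (cRes_le _ _))
      (hW.mono (le_inf hW.prop.1 (hWV.trans le_sup_left)) inf_le_left)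
      (sup_le (hWn V hV.prop.2 hWV) (hWn V₁ hV₁.prop.2 hWV₁))
      (hV₁.mono le_sup_right le_top) (hV.mono le_sup_left le_top) hWV₁ hWV
    refine ⟨x⁻¹, Subgroup.inv_mem _ (cRes_le_nPiResidualOf π _ (hρ _ ▸ hx)), ?_⟩
    rw [conjSubgroup, inv_inv]
    exact hxV
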